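/- \textbf{Theorem.} Let $\mathbb{K}$ be $\mathbb{R}$ or $\mathbb{C}$, let $m,n,k\ge 0$ be integers with $k\le m$ and $k\le n$, and let $C^\infty(\mathbb{R}^d)$ denote the algebra of smooth $\mathbb{K}$-valued functions on $\mathbb{R}^d$. Let $p:\mathbb{R}^n\to\mathbb{R}^m$, $p(x_1,\dots,x_n)=(x_1,\dots,x_k,0,\dots,0)$, be the projection on the first $k$ coordinates. Let $\operatorname{DiffOp}(\mathbb{R}^n)$ be the space of differential operators $D=\sum_I D^I\partial^I$ (finite sums over multiindices $I\in\mathbb{N}_0^n$, with $D^I\in C^\infty(\mathbb{R}^n)$) acting on $C^\infty(\mathbb{R}^n)$. It is a $C^\infty(\mathbb{R}^m)$-bimodule by $(a\cdot D\cdot b)(f)=(p^*a)\,D\big((p^*b)f\big)$. Let $\operatorname{DiffOp_{ver}}(\mathbb{R}^n)$ be the left submodule of those operators $\sum_I D^I\partial^I$ in which only multiindices $I$ with $I_1=\dots=I_k=0$ occur. For $q\ge 0$ let $\mathrm{HC}^q_{\mathrm{diff}}$ be the space of $\mathbb{K}$-multilinear maps $f:C^\infty(\mathbb{R}^m)^q\to\operatorname{DiffOp}(\mathbb{R}^n)$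 that are multidifferential operators, that is, finite sums of maps $(a_1,\dots,a_q)\mapsto p^*(\partial^{I_1}a_1\cdots\partial^{I_q}a_q)\,\psi$ with $I_1,\dots,I_q\in\mathbb{N}_0^m$ and $\psi\in\operatorname{DiffOp}(\mathbb{R}^n)$. Let $$(\delta f)(a_0,\dots,a_q)=a_0\cdot f(a_1,\dots,a_q)+\sum_{j=0}^{q-1}(-1)^{j+1}f(a_0,\dots,a_ja_{j+1},\dots,a_q)+(-1)^{q+1}f(a_0,\dots,a_{q-1})\cdot a_q$$ be the Hochschild differential, and let $\mathrm{HH}^q_{\mathrm{diff}}(C^\infty(\mathbb{R}^m),\operatorname{DiffOp}(\mathbb{R}^n))$ be the $q$-th cohomology of $(\mathrm{HC}^\bullet_{\mathrm{diff}},\delta)$. It is a $C^\infty(\mathbb{R}^m)$-module through the left action on values. Then for every $q\ge 0$ $$\mathrm{HH}^q_{\mathrm{diff}}\big(C^\infty(\mathbb{R}^m),\operatorname{DiffOp}(\mathbb{R}^n)\big)\;\cong\;\Lambda^q(\mathbb{R}^{m-k})\otimes_{\mathbb{R}}\operatorname{DiffOp_{ver}}(\mathbb{R}^n)$$ as $C^\infty(\mathbb{R}^m)$-modules,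 where $a\in C^\infty(\mathbb{R}^m)$ acts on the right-hand side by left multiplication with $p^*a$ on the second factor. -/

import Mathlib

open scoped ContDiff TensorProduct

noncomputable section

/-! ### Hochschild cochains of a commutative algebra with values in a bimodule

A bimodule `M` over the commutative algebra `A` is a left `A`-module together with a commuting
right `A`-module structure; the latter is written as a module structure over `Aᵐᵒᵖ`, so that
`m · a` is `MulOpposite.op a • m`. -/

section Hochschild

/-- Hochschild `q`-cochains: `R`-multilinear maps `A × ⋯ × A → M` (`q` factors). -/
abbrev HochschildCochain (R A M : Type*) [CommRing R] [CommRing A] [Algebra R A]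
    [AddCommGroup M] [Module R M] (q : ℕ) : Type _ :=
  MultilinearMap R (fun _ : Fin q => A) M

variable {R A M : Type*} [CommRing R] [CommRing A] [Algebra R A] [AddCommGroup M] [Module R M]

theorem contractNth_update {q : ℕ} (j : Fin q) (a : Fin (q + 1) → A) (i : Fin (q + 1)) (x : A) :
    Fin.contractNth j.castSucc (· * ·) (Function.update a i x) =
      Function.update (Fin.contractNth j.castSucc (· * ·) a) (j.predAbove i)
        ((if i = j.castSucc then a j.succ else if i = j.succ then a j.castSucc else 1) * x) := by
  have hp : (j.predAbove i : ℕ) = if (j : ℕ) < i then (i : ℕ) - 1 else i := by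
    rw [Fin.predAbove]
    by_cases h : j.castSucc < i
    · rw [dif_pos h, if_pos (by simpa [Fin.lt_def] using h), Fin.val_pred]
    · rw [dif_neg h, if_neg (by simpa [Fin.lt_def] using h), Fin.coe_castPred]
  generalize j.predAbove i = p at hp ⊢
  funext k
  obtain ⟨j, hj⟩ := j
  obtain ⟨i, hi⟩ := i
  obtain ⟨k, hk⟩ := k
  obtain ⟨p, hpq⟩ := p
  simp only at hp
  simp only [Fin.contractNth, Function.update_apply, Fin.ext_iff, Fin.castSucc_mk, Fin.succ_mk]
  split_ifs at hp ⊢ <;> grind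

/-- The face `(a₀, …, a_q) ↦ f(a₀, …, a_j a_{j+1}, …, a_q)`. -/
def hochschildInnerFace {q : ℕ} (j : Fin q) (f : HochschildCochain R A M q) :
    HochschildCochain R A M (q + 1) :=
  MultilinearMap.mk' (fun a => f (Fin.contractNth j.castSucc (· * ·) a))
    (by
      intro a i x y
      simp only [contractNth_update, mul_add, MultilinearMap.map_update_add])
    (by
      intro a i c x
      simp only [contractNth_update, mul_smul_comm, MultilinearMap.map_update_smul])

theorem hochschildInnerFace_apply {q : ℕ} (j : Fin q) (f : HochschildCochain R A M q)
    (a : Fin (q + 1) → A) : hochschildInnerFace j f a = f (Fin.contractNth j.castSucc (· * ·) a) := rfl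

section FirstFace

variable [Module A M] [IsScalarTower R A M]

/-- The face `(a₀, …, a_q) ↦ a₀ · f(a₁, …, a_q)`. -/
def hochschildFirstFace {q : ℕ} (f : HochschildCochain R A M q) :
    HochschildCochain R A M (q + 1) :=
  MultilinearMap.mk' (fun a => a 0 • f (Fin.tail a))
    (by
      intro a i
      refine Fin.cases ?_ (fun i => ?_) i
      · intro x y
        simp [add_smul]
      · intro x y
        simp [smul_add, Fin.tail_update_succ, Function.update_of_ne (Fin.succ_ne_zero i).symm])
    (by
      intro a i
      refine Fin.cases ?_ (fun i => ?_) i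
      · intro c x
        simp
      · intro c x
        simp [Fin.tail_update_succ, Function.update_of_ne (Fin.succ_ne_zero i).symm,
          smul_comm c (a 0)])

theorem hochschildFirstFace_apply {q : ℕ} (f : HochschildCochain R A M q)
    (a : Fin (q + 1) → A) : hochschildFirstFace f a = a 0 • f (Fin.tail a) := rfl

end FirstFace

variable [Module Aᵐᵒᵖ M] [IsScalarTower R Aᵐᵒᵖ M]

/-- The face `(a₀, …, a_q) ↦ f(a₀, …, a_{q-1}) · a_q`. -/
def hochschildLastFace {q : ℕ} (f : HochschildCochain R A M q) :
    HochschildCochain R A M (q + 1) :=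
  MultilinearMap.mk' (fun a => MulOpposite.op (a (Fin.last q)) • f (Fin.init a))
    (by
      intro a i
      refine Fin.lastCases ?_ (fun i => ?_) i
      · intro x y
        simp [add_smul]
      · intro x y
        simp [smul_add, Fin.init_update_castSucc, (Fin.castSucc_lt_last i).ne'])
    (by
      intro a i
      refine Fin.lastCases ?_ (fun i => ?_) i
      · intro c x
        simp
      · intro c x
        simp [Fin.init_update_castSucc, (Fin.castSucc_lt_last i).ne',
          smul_comm c (MulOpposite.op (a (Fin.last q)))])

theorem hochschildLastFace_apply {q : ℕ} (f : HochschildCochain R A M q)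
    (a : Fin (q + 1) → A) : hochschildLastFace f a = 
    MulOpposite.op (a (Fin.last q)) • f (Fin.init a) := rfl

variable [Module A M] [IsScalarTower R A M] [SMulCommClass A Aᵐᵒᵖ M]

variable (R A M) in
/-- The Hochschild differential
`(δf)(a₀, …, a_q) = a₀ · f(a₁, …, a_q) + ∑_{j < q} (-1)^(j+1) f(a₀, …, a_j a_{j+1}, …, a_q)
  + (-1)^(q+1) f(a₀, …, a_{q-1}) · a_q`;
it is linear for the left action of `A` on the values of cochains. -/
def hochschildDifferential (q : ℕ) :
    HochschildCochain R A M q →ₗ[A] HochschildCochain R A M (q + 1) where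
  toFun f := hochschildFirstFace f + ∑ j : Fin q, (-1 : ℤ) ^ (j.val + 1) • hochschildInnerFace j f
    + (-1 : ℤ) ^ (q + 1) • hochschildLastFace f
  map_add' f g := by
    ext a
    simp only [add_apply, sum_apply, smul_apply, hochschildFirstFace_apply,
      hochschildInnerFace_apply, hochschildLastFace_apply, smul_add, Finset.sum_add_distrib]
    abel
  map_smul' c f := by
    ext a
    simp only [add_apply, sum_apply, smul_apply, hochschildFirstFace_apply,
      hochschildInnerFace_apply, hochschildLastFace_apply, smul_add, Finset.smul_sum,
      RingHom.id_apply]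
    rw [smul_comm (a 0) c, ← smul_comm c (MulOpposite.op (a (Fin.last q)))]
    simp only [fun (z : ℤ) (y : M) => smul_comm z c y]

end Hochschild

/-! ### Smooth functions and differential operators on `ℝⁿ` -/

section Smooth

variable (𝕜 : Type*) [RCLike 𝕜]

/-- Smooth functions `ℝⁿ → 𝕜` as a subalgebra of all functions. -/
def smoothSubalgebra (n : ℕ) : Subalgebra 𝕜 ((Fin n → ℝ) → 𝕜) where
  carrier := {f | ContDiff ℝ ∞ f}
  mul_mem' {f g} (hf : ContDiff ℝ ∞ f) (hg : ContDiff ℝ ∞ g) := hf.mul hg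
  add_mem' {f g} (hf : ContDiff ℝ ∞ f) (hg : ContDiff ℝ ∞ g) := hf.add hg
  algebraMap_mem' c := (contDiff_const : ContDiff ℝ ∞ fun _ : Fin n → ℝ => c)

/-- The algebra `C^∞(ℝⁿ)` of smooth `𝕜`-valued functions, where `𝕜` is `ℝ` or `ℂ`. -/
def SmoothFun (n : ℕ) : Type _ := smoothSubalgebra 𝕜 n

instance (n : ℕ) : CommRing (SmoothFun 𝕜 n) := inferInstanceAs (CommRing (smoothSubalgebra 𝕜 n))

instance (n : ℕ) : Algebra 𝕜 (SmoothFun 𝕜 n) :=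
  inferInstanceAs (Algebra 𝕜 (smoothSubalgebra 𝕜 n))

namespace SmoothFun

variable {𝕜} {n : ℕ}

theorem contDiff (f : SmoothFun 𝕜 n) : ContDiff ℝ ∞ f.1 := f.2

theorem differentiable (f : SmoothFun 𝕜 n) : Differentiable ℝ f.1 :=
  f.contDiff.differentiable (by simp)

theorem ext {f g : SmoothFun 𝕜 n} (h : ∀ x, f.1 x = g.1 x) : f = g :=
  Subtype.ext (funext h)

end SmoothFun

variable {𝕜} in
/-- The pullback `a ↦ a ∘ φ` along a smooth map `φ : ℝⁿ → ℝᵐ`, as an algebra morphism. -/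
def smoothPullback {m n : ℕ} (φ : (Fin n → ℝ) → (Fin m → ℝ)) (hφ : ContDiff ℝ ∞ φ) :
    SmoothFun 𝕜 m →ₐ[𝕜] SmoothFun 𝕜 n where
  toFun a := ⟨fun x => a.1 (φ x), a.contDiff.comp hφ⟩
  map_one' := rfl
  map_mul' _ _ := rfl
  map_zero' := rfl
  map_add' _ _ := rfl
  commutes' _ := rfl

/-- The partial derivative `∂_i` on `C^∞(ℝⁿ)`. -/
def partialDeriv (n : ℕ) (i : Fin n) : Module.End 𝕜 (SmoothFun 𝕜 n) where
  toFun f := ⟨fun x => fderiv ℝ f.1 x (Pi.single i 1),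
    (f.contDiff.fderiv_right (m := ∞) (by simp)).clm_apply contDiff_const⟩
  map_add' f g := SmoothFun.ext fun x =>
    congrArg (fun L : (Fin n → ℝ) →L[ℝ] 𝕜 => L (Pi.single i 1))
      (fderiv_add (f.differentiable x) (g.differentiable x))
  map_smul' c f := SmoothFun.ext fun x =>
    congrArg (fun L : (Fin n → ℝ) →L[ℝ] 𝕜 => L (Pi.single i 1))
      (fderiv_const_smul (f.differentiable x) c)

/-- The iterated partial derivative `∂^I = ∂₁^{I₁} ⋯ ∂ₙ^{Iₙ}` for a multiindex `I`. -/
def iteratedPartial (n : ℕ) (I : Fin n → ℕ) : Module.End 𝕜 (SmoothFun 𝕜 n) :=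
  (List.ofFn fun i => partialDeriv 𝕜 n i ^ I i).prod

/-- The operator of multiplication by `b`. -/
def mulOperator {n : ℕ} (b : SmoothFun 𝕜 n) : Module.End 𝕜 (SmoothFun 𝕜 n) :=
  LinearMap.mulLeft 𝕜 b

/-- The differential operators `D = ∑_I D^I ∂^I` (finite sums, `D^I ∈ C^∞(ℝⁿ)`), as a
`C^∞(ℝⁿ)`-submodule of the linear endomorphisms of `C^∞(ℝⁿ)`. -/
def DiffOp (n : ℕ) : Submodule (SmoothFun 𝕜 n) (Module.End 𝕜 (SmoothFun 𝕜 n)) :=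
  Submodule.span (SmoothFun 𝕜 n) (Set.range (iteratedPartial 𝕜 n))

theorem partialDeriv_mul {n : ℕ} (i : Fin n) (f g : SmoothFun 𝕜 n) :
    partialDeriv 𝕜 n i (f * g) = f * partialDeriv 𝕜 n i g + partialDeriv 𝕜 n i f * g := by
  refine SmoothFun.ext fun x => ?_
  have := congrArg (fun L : (Fin n → ℝ) →L[ℝ] 𝕜 => L (Pi.single i 1))
    (fderiv_mul (f.differentiable x) (g.differentiable x))
  refine this.trans ?_
  change f.1 x * fderiv ℝ g.1 x (Pi.single i 1) + g.1 x * fderiv ℝ f.1 x (Pi.single i 1) =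
    f.1 x * fderiv ℝ g.1 x (Pi.single i 1) + fderiv ℝ f.1 x (Pi.single i 1) * g.1 x
  rw [mul_comm (g.1 x)]

theorem partialDeriv_comm {n : ℕ} (i j : Fin n) :
    Commute (partialDeriv 𝕜 n i) (partialDeriv 𝕜 n j) := by
  refine LinearMap.ext fun f => SmoothFun.ext fun x => ?_
  have hs : IsSymmSndFDerivAt ℝ f.1 x :=
    (f.contDiff.contDiffAt ).isSymmSndFDerivAt (by
      rw [minSmoothness_of_isRCLikeNormedField]
      exact WithTop.coe_le_coe.2 le_top)
  have hd : Differentiable ℝ (fderiv ℝ f.1) :=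
    (f.contDiff.fderiv_right (m := ∞) (by simp)).differentiable (by simp)
  have key : ∀ v w : Fin n → ℝ, fderiv ℝ (fun y => fderiv ℝ f.1 y v) x w
      = fderiv ℝ (fderiv ℝ f.1) x w v := by
    intro v w
    rw [fderiv_clm_apply (hd x) (differentiableAt_const v)]
    simp
  change fderiv ℝ (fun y => fderiv ℝ f.1 y (Pi.single j 1)) x (Pi.single i 1)
    = fderiv ℝ (fun y => fderiv ℝ f.1 y (Pi.single i 1)) x (Pi.single j 1)
  rw [key, key]
  exact hs _ _

theorem prod_ofFn_pow_add_single {G : Type*} [Monoid G] {n : ℕ} (a : Fin n → G)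
    (h : ∀ i j, Commute (a i) (a j)) (I : Fin n → ℕ) (i : Fin n) :
    a i * (List.ofFn fun j => a j ^ I j).prod =
      (List.ofFn fun j => a j ^ (I + Pi.single i 1 : Fin n → ℕ) j).prod := by
  induction n with
  | zero => exact i.elim0
  | succ n ih =>
    simp only [List.ofFn_succ, List.prod_cons]
    revert i
    refine Fin.cases ?_ (fun i => ?_)
    · simp [pow_succ', mul_assoc]
    · have := ih (fun j => a j.succ) (fun i j => h _ _) (fun j => I j.succ) i
      rw [← mul_assoc, ((h i.succ 0).pow_right (I 0)).eq, mul_assoc, this]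
      simp [Pi.single_apply, Fin.ext_iff]

theorem partialDeriv_mul_mem_diffOp {n : ℕ} (i : Fin n) {D : Module.End 𝕜 (SmoothFun 𝕜 n)}
    (hD : D ∈ DiffOp 𝕜 n) : partialDeriv 𝕜 n i * D ∈ DiffOp 𝕜 n := by
  induction hD using Submodule.span_induction with
  | mem D hD =>
    obtain ⟨I, rfl⟩ := hD
    refine Submodule.subset_span ⟨I + Pi.single i 1, ?_⟩
    exact (prod_ofFn_pow_add_single _ (partialDeriv_comm 𝕜) I i).symm
  | zero => simp
  | add D E _ _ hD hE => rw [mul_add]; exact add_mem hD hE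
  | smul c D h hD =>
    have : partialDeriv 𝕜 n i * (c • D) = c • (partialDeriv 𝕜 n i * D) +
        partialDeriv 𝕜 n i c • D := by
      refine LinearMap.ext fun f => ?_
      exact partialDeriv_mul 𝕜 i c (D f)
    rw [this]
    exact add_mem (Submodule.smul_mem _ _ hD) (Submodule.smul_mem _ _ h)

theorem iteratedPartial_mul_mem_diffOp {n : ℕ} (I : Fin n → ℕ)
    {D : Module.End 𝕜 (SmoothFun 𝕜 n)} (hD : D ∈ DiffOp 𝕜 n) :
    iteratedPartial 𝕜 n I * D ∈ DiffOp 𝕜 n := by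
  have hpow : ∀ (i : Fin n) (r : ℕ) (E : Module.End 𝕜 (SmoothFun 𝕜 n)), E ∈ DiffOp 𝕜 n →
      partialDeriv 𝕜 n i ^ r * E ∈ DiffOp 𝕜 n := by
    intro i r
    induction r with
    | zero => intro E hE; simpa using hE
    | succ r ih =>
      intro E hE
      rw [pow_succ, mul_assoc]
      exact ih _ (partialDeriv_mul_mem_diffOp 𝕜 i hE)
  have hlist : ∀ l : List (Module.End 𝕜 (SmoothFun 𝕜 n)),
      (∀ T ∈ l, ∀ E ∈ DiffOp 𝕜 n, T * E ∈ DiffOp 𝕜 n) → l.prod * D ∈ DiffOp 𝕜 n := by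
    intro l
    induction l with
    | nil => intro _; simpa using hD
    | cons T l ih =>
      intro hl
      rw [List.prod_cons, mul_assoc]
      exact hl T (by simp) _ (ih fun S hS => hl S (by simp [hS]))
  refine hlist _ fun T hT E hE => ?_
  obtain ⟨i, rfl⟩ := (List.mem_ofFn' _ _).1 hT
  exact hpow i _ E hE

/-- Differential operators are closed under composition on the right with multiplications. -/
theorem diffOp_mul_mulOperator_mem {n : ℕ} {D : Module.End 𝕜 (SmoothFun 𝕜 n)}
    (hD : D ∈ DiffOp 𝕜 n) (b : SmoothFun 𝕜 n) : D * mulOperator 𝕜 b ∈ DiffOp 𝕜 n := by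
  have hb : mulOperator 𝕜 b ∈ DiffOp 𝕜 n := by
    have h1 : iteratedPartial 𝕜 n 0 = 1 := by simp [iteratedPartial]
    have h2 : mulOperator 𝕜 b = b • iteratedPartial 𝕜 n 0 := by
      rw [h1]; rfl
    rw [h2]
    exact Submodule.smul_mem _ _ (Submodule.subset_span ⟨0, rfl⟩)
  induction hD using Submodule.span_induction with
  | mem D hD =>
    obtain ⟨I, rfl⟩ := hD
    exact iteratedPartial_mul_mem_diffOp 𝕜 I hb
  | zero => simp
  | add D E _ _ hD hE => rw [add_mul]; exact add_mem hD hE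
  | smul c D _ hD => exact Submodule.smul_mem _ c hD

/-! ### Differential operators as a bimodule over the functions on another space -/

variable {𝕜} {m n : ℕ}

/-- The space `DiffOp(ℝⁿ)`, regarded as a `C^∞(ℝᵐ)`-bimodule along an algebra morphism
`p : C^∞(ℝᵐ) → C^∞(ℝⁿ)` through `(a · D · b)(f) = p a · D (p b · f)`. -/
def DiffOpAlong (_p : SmoothFun 𝕜 m →ₐ[𝕜] SmoothFun 𝕜 n) : Type _ := DiffOp 𝕜 n

namespace DiffOpAlong

variable (p : SmoothFun 𝕜 m →ₐ[𝕜] SmoothFun 𝕜 n)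

instance : AddCommGroup (DiffOpAlong p) := inferInstanceAs (AddCommGroup (DiffOp 𝕜 n))

instance : Module 𝕜 (DiffOpAlong p) := inferInstanceAs (Module 𝕜 (DiffOp 𝕜 n))

/-- The left action `a · D = p a ∘ D`. -/
instance : Module (SmoothFun 𝕜 m) (DiffOpAlong p) :=
  Module.compHom (DiffOp 𝕜 n) p.toRingHom

/-- The right action `D · b = D ∘ p b`. -/
instance : Module (SmoothFun 𝕜 m)ᵐᵒᵖ (DiffOpAlong p) where
  smul b D := (⟨D.1 * mulOperator 𝕜 (p b.unop), diffOp_mul_mulOperator_mem 𝕜 D.2 _⟩ : DiffOp 𝕜 n)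
  one_smul D := by
    refine Subtype.ext (LinearMap.ext fun f => ?_)
    change D.1 (p 1 * f) = D.1 f
    simp
  mul_smul b c D := by
    refine Subtype.ext (LinearMap.ext fun f => ?_)
    change D.1 (p (c.unop * b.unop) * f) = D.1 (p c.unop * (p b.unop * f))
    rw [_root_.map_mul p, mul_assoc]
  smul_zero b := rfl
  smul_add b D E := rfl
  add_smul b c D := by
    refine Subtype.ext (LinearMap.ext fun f => ?_)
    change D.1 (p (b.unop + c.unop) * f) = D.1 (p b.unop * f) + D.1 (p c.unop * f)
    rw [map_add, add_mul, map_add]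
  zero_smul D := by
    refine Subtype.ext (LinearMap.ext fun f => ?_)
    change D.1 (p 0 * f) = 0
    simp

theorem left_smul_apply (a : SmoothFun 𝕜 m) (D : DiffOpAlong p) (f : SmoothFun 𝕜 n) :
    (a • D).1 f = p a * D.1 f := rfl

theorem right_smul_apply (b : SmoothFun 𝕜 m) (D : DiffOpAlong p) (f : SmoothFun 𝕜 n) :
    (MulOpposite.op b • D).1 f = D.1 (p b * f) := rfl

instance : IsScalarTower 𝕜 (SmoothFun 𝕜 m) (DiffOpAlong p) where
  smul_assoc c a D := by
    refine Subtype.ext (LinearMap.ext fun f => ?_)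
    change p (c • a) * D.1 f = c • (p a * D.1 f)
    rw [map_smul, smul_mul_assoc]

instance : IsScalarTower 𝕜 (SmoothFun 𝕜 m)ᵐᵒᵖ (DiffOpAlong p) where
  smul_assoc c b D := by
    refine Subtype.ext (LinearMap.ext fun f => ?_)
    change D.1 (p (c • b.unop) * f) = c • D.1 (p b.unop * f)
    rw [map_smul, smul_mul_assoc, map_smul]

instance : SMulCommClass (SmoothFun 𝕜 m) (SmoothFun 𝕜 m)ᵐᵒᵖ (DiffOpAlong p) where
  smul_comm _ _ _ := rfl

end DiffOpAlong

/-! ### The differential Hochschild complex of `C^∞(ℝᵐ)` and its cohomology -/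

section Cohomology

variable (𝕜 m)
variable (M : Type*) [AddCommGroup M] [Module 𝕜 M] [Module (SmoothFun 𝕜 m) M]
  [IsScalarTower 𝕜 (SmoothFun 𝕜 m) M]

/-- The differential Hochschild cochains: finite sums of cochains of the form
`(a₁, …, a_q) ↦ (∂^{I₁} a₁ ⋯ ∂^{I_q} a_q) · ψ` with multiindices `I₁, …, I_q` and `ψ ∈ M`. -/
def diffCochain (q : ℕ) :
    Submodule (SmoothFun 𝕜 m) (HochschildCochain 𝕜 (SmoothFun 𝕜 m) M q) :=
  Submodule.span (SmoothFun 𝕜 m)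
    {f | ∃ (I : Fin q → Fin m → ℕ) (ψ : M),
      ∀ a, f a = (∏ j, iteratedPartial 𝕜 m (I j) (a j)) • ψ}

variable [Module (SmoothFun 𝕜 m)ᵐᵒᵖ M] [IsScalarTower 𝕜 (SmoothFun 𝕜 m)ᵐᵒᵖ M]
  [SMulCommClass (SmoothFun 𝕜 m) (SmoothFun 𝕜 m)ᵐᵒᵖ M]

/-- Differential cocycles of degree `q`. -/
def diffCocycle (q : ℕ) :
    Submodule (SmoothFun 𝕜 m) (HochschildCochain 𝕜 (SmoothFun 𝕜 m) M q) :=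
  diffCochain 𝕜 m M q ⊓ LinearMap.ker (hochschildDifferential 𝕜 (SmoothFun 𝕜 m) M q)

/-- Differential coboundaries of degree `q`: the differentials of the differential cochains of
degree `q - 1`. -/
def diffCoboundary :
    (q : ℕ) → Submodule (SmoothFun 𝕜 m) (HochschildCochain 𝕜 (SmoothFun 𝕜 m) M q)
  | 0 => ⊥
  | q + 1 => (diffCochain 𝕜 m M q).map (hochschildDifferential 𝕜 (SmoothFun 𝕜 m) M q)

/-- The differential Hochschild cohomology `HH^q_diff(C^∞(ℝᵐ), M)`: differential cocycles modulo
differential coboundaries. -/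
abbrev DiffHochschildCohomology (q : ℕ) : Type _ :=
  diffCocycle 𝕜 m M q ⧸ (diffCoboundary 𝕜 m M q).submoduleOf (diffCocycle 𝕜 m M q)

end Cohomology

/-! ### The projection on the first `k` coordinates and the vertical operators -/

section Projection

variable {k : ℕ}

/-- The map `ℝⁿ → ℝᵐ`, `(x₁, …, xₙ) ↦ (x₁, …, x_k, 0, …, 0)`. -/
def coordProj (m : ℕ) (hkn : k ≤ n) (x : Fin n → ℝ) : Fin m → ℝ := fun i =>
  if h : (i : ℕ) < k then x ⟨i, h.trans_le hkn⟩ else 0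

theorem contDiff_coordProj (m : ℕ) (hkn : k ≤ n) : ContDiff ℝ ∞ (coordProj m hkn) := by
  refine contDiff_pi.2 fun i => ?_
  unfold coordProj
  split_ifs with h
  · exact contDiff_apply ℝ ℝ _
  · exact contDiff_const

variable (𝕜) in
/-- The pullback `C^∞(ℝᵐ) → C^∞(ℝⁿ)` along the projection on the first `k` coordinates. -/
def coordProjPullback (m : ℕ) (hkn : k ≤ n) : SmoothFun 𝕜 m →ₐ[𝕜] SmoothFun 𝕜 n :=
  smoothPullback (coordProj m hkn) (contDiff_coordProj m hkn)

variable (𝕜) in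
/-- The vertical differential operators: those `D = ∑_I D^I ∂^I` (finite sums,
`D^I ∈ C^∞(ℝⁿ)`) in which only derivatives in the coordinates after the `k`-th one occur. -/
def DiffOpVer (m : ℕ) (hkn : k ≤ n) :
    Submodule (SmoothFun 𝕜 m) (DiffOpAlong (coordProjPullback 𝕜 m hkn)) where
  carrier := {D | D.1 ∈ Submodule.span (SmoothFun 𝕜 n)
    (iteratedPartial 𝕜 n '' {I | ∀ i : Fin n, (i : ℕ) < k → I i = 0})}
  add_mem' hD hE := Submodule.add_mem (Submodule.span (SmoothFun 𝕜 n) _) hD hE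
  zero_mem' := zero_mem (Submodule.span (SmoothFun 𝕜 n) _)
  smul_mem' _ _ hD := Submodule.smul_mem (Submodule.span (SmoothFun 𝕜 n) _) _ hD

/-- The real vector space structure underlying the `𝕜`-vector space structure. -/
instance (m : ℕ) (hkn : k ≤ n) : Module ℝ (DiffOpVer 𝕜 m hkn) :=
  Module.compHom _ (algebraMap ℝ 𝕜)

instance (m : ℕ) (hkn : k ≤ n) : SMulCommClass ℝ (SmoothFun 𝕜 m) (DiffOpVer 𝕜 m hkn) where
  smul_comm c a D := smul_comm (algebraMap ℝ 𝕜 c) a D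

instance (m : ℕ) (hkn : k ≤ n) : SMulCommClass (SmoothFun 𝕜 m) ℝ (DiffOpVer 𝕜 m hkn) where
  smul_comm a c D := smul_comm a (algebraMap ℝ 𝕜 c) D

end Projection

end Smooth

end

/-!
# Differential Hochschild cohomology of differential operators along a projection

A differential cochain is determined by its symbol, obtained by evaluating it on exponential
functions.  The symbol is a polynomial `F(ξ⁰, …, ξ^(q-1), s)`: the vector `ξˡ` records the
derivatives of the `l`-th argument, and `s` the derivatives along the first `k` coordinates in the
value; the coefficients are the symbols of vertical operators.  By the Leibniz rule the Hochschild
differential becomes `F(ξ¹, …, s) - F(ξ⁰ + ξ¹, …, s) + ⋯ ± F(ξ⁰, …, ξ^q + s)`, the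
differential of polynomial cochains of an additive group in `m` dimensions with values in the
functions of `s`, on which the group acts by translation
(`hochschildDifferential_symbolCochain`).  Only the first `k` coordinates of `s` occur.

The cohomology of this complex is computed by descending induction on the number `j` of
coordinates of `s` that may occur (`PolyCobar.mem_normalForms_sup_activeCoboundaries`).  If all of
them may occur, then setting `s = 0` is a contracting homotopy.  In the step from `j + 1` to `j`, a
cocycle `F` that does not depend on the coordinate `s_j` is, up to normal forms, the coboundary of
some `G`, and `∂G/∂s_j` is a cocycle of lower degree.  By induction it is a normal form `E` plus a
coboundary; subtracting `s_j E` and an antiderivative of the coboundary makes `G` independent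
of `s_j`, and `s_j E` contributes the cup product of `E` with the linear cocycle `ξ_j` to `F`.
Hence the monomials `ξ⁰_{c 0} ⋯ ξ^(q-1)_{c (q-1)}` with `c 0 > ⋯ > c (q-1) ≥ k` span the
cohomology over the vertical symbols.

These classes are independent: the alternating sum of the values of a cochain on the coordinate
functions `x_{c 0}, …, x_{c (q-1)}` vanishes on coboundaries, since the inner faces are
symmetric in two arguments and the projection kills `x_i` for `i ≥ k`, while it recovers the
coefficients of a cocycle in normal form (`altEval_normalCochain`).  So the cohomology is a power
of the module of vertical operators indexed by the sets of `q` among the last `m - k` directions,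
and such sets index a basis of the exterior power.
-/

noncomputable section

/-! ### The polynomial complex -/

namespace PolyCobar

open MvPolynomial

variable {B : Type*} [CommRing B] {m : ℕ}

/-- The ring `B[ξ⁰, …, ξ^q]`, where each `ξˡ` stands for `m` variables.  Its elements are
the polynomial functions `F(ξ⁰, …, ξ^q)` of `q + 1` vectors; they are the polynomial cochains of
degree `q` of the additive group in `m` dimensions, with values in the functions of the last
vector, on which the group acts by translation. -/
abbrev Cochain (B : Type*) [CommRing B] (m q : ℕ) : Type _ := MvPolynomial (Fin (q + 1) × Fin m) B

/-- The coface `F ↦ F(ξ¹, …, ξ^(q+1))` for `j = 0`, and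
`F ↦ F(ξ⁰, …, ξ^(j-1) + ξ^j, …, ξ^(q+1))` for `j > 0`. -/
def coface {q : ℕ} (j : Fin (q + 2)) : Cochain B m q →ₐ[B] Cochain B m (q + 1) :=
  aeval fun v => (if v.1.castSucc < j then X (v.1.castSucc, v.2) else 0) +
    (if j ≤ v.1.succ then X (v.1.succ, v.2) else 0)

theorem coface_X {q : ℕ} (j : Fin (q + 2)) (v : Fin (q + 1) × Fin m) :
    coface (B := B) j (X v) = (if v.1.castSucc < j then X (v.1.castSucc, v.2) else 0) +
    (if j ≤ v.1.succ then X (v.1.succ, v.2) else 0) := by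
  simp [coface]

/-- The alternating sum of the cofaces. -/
def diff (q : ℕ) : Cochain B m q →ₗ[B] Cochain B m (q + 1) :=
  ∑ j : Fin (q + 2), (-1 : ℤ) ^ (j : ℕ) • (coface j).toLinearMap

theorem diff_apply {q : ℕ} (F : Cochain B m q) :
    diff q F = ∑ j : Fin (q + 2), (-1 : ℤ) ^ (j : ℕ) • coface j F := by
  simp [diff]

/-- The cosimplicial identity for the cofaces. -/
theorem coface_coface {q : ℕ} (i : Fin (q + 2)) (j : Fin (q + 3)) (h : (j : ℕ) ≤ i)
    (F : Cochain B m q) :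
    coface j (coface i F) = coface i.succ (coface (j.castLT (by omega)) F) := by
  suffices H : (coface j).comp (coface (B := B) (m := m) i) =
      (coface i.succ).comp (coface (j.castLT (by omega))) from DFunLike.congr_fun H F
  refine MvPolynomial.algHom_ext fun v => ?_
  obtain ⟨⟨l, hl⟩, c⟩ := v
  obtain ⟨i, hi⟩ := i
  obtain ⟨j, hj⟩ := j
  simp only at h
  simp only [AlgHom.comp_apply, coface_X, map_add, apply_ite (coface _), map_zero,
    Fin.castLT_mk, Fin.castSucc_mk, Fin.succ_mk, Fin.mk_lt_mk, Fin.mk_le_mk]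
  split_ifs <;> first | omega | simp [add_assoc]

theorem diff_diff {q : ℕ} (F : Cochain B m q) : diff (q + 1) (diff q F) = 0 := by
  simp only [diff_apply, map_sum, map_zsmul, Finset.smul_sum]
  simp only [← Finset.sum_product']
  let S : Finset (Fin (q + 2) × Fin (q + 3)) := {ij | (ij.2 : ℕ) ≤ ij.1}
  rw [Finset.univ_product_univ, ← Finset.sum_add_sum_compl S, ← eq_neg_iff_add_eq_zero,
    ← Finset.sum_neg_distrib]
  refine Finset.sum_bij (fun ij hij => (Fin.castLT ij.2
    (lt_of_le_of_lt (Finset.mem_filter.mp hij).right (Fin.is_lt ij.1)), ij.1.succ)) ?_ ?_ ?_ ?_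
  · intro ij hij
    simp_rw [S, Finset.compl_filter, Finset.mem_filter_univ, Fin.val_succ, Fin.val_castLT] at hij ⊢
    omega
  · rintro ⟨i, j⟩ hij ⟨i', j'⟩ hij' h
    simp only [Prod.mk.injEq, Fin.ext_iff, Fin.val_castLT, Fin.val_succ] at h ⊢
    omega
  · rintro ⟨i', j'⟩ hij'
    simp_rw [S, Finset.compl_filter, Finset.mem_filter_univ, not_le] at hij'
    refine ⟨(j'.pred ?_, Fin.castSucc i'), ?_, ?_⟩
    · rintro rfl
      simp at hij'
    · simp only [S, Finset.mem_filter_univ, Fin.val_pred, Fin.val_castSucc]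
      omega
    · simp
  · rintro ⟨i, j⟩ hij
    rw [coface_coface i j (Finset.mem_filter.mp hij).2]
    simp only [smul_smul, ← neg_smul]
    congr 1
    simp only [Fin.val_succ, Fin.val_castLT]
    ring

/-- Setting the last vector to zero. -/
def setLastZero (q : ℕ) : Cochain B m (q + 1) →ₐ[B] Cochain B m q :=
  aeval fun v => Fin.lastCases (motive := fun _ => Cochain B m q) 0 (fun l => X (l, v.2)) v.1

/-- Setting the last vector to zero commutes with every coface but the last one, of which it is a
left inverse by `setLastZero_coface_last`; this makes it a contracting homotopy. -/
theorem setLastZero_coface_castSucc {q : ℕ} (j : Fin (q + 2)) (F : Cochain B m (q + 1)) :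
    setLastZero (q + 1) (coface j.castSucc F) = coface j (setLastZero q F) := by
  suffices H : (setLastZero (q + 1)).comp (coface (B := B) (m := m) j.castSucc) =
      (coface j).comp (setLastZero q) from DFunLike.congr_fun H F
  refine MvPolynomial.algHom_ext fun v => ?_
  obtain ⟨l, c⟩ := v
  induction l using Fin.lastCases with
  | last =>
    simp only [AlgHom.comp_apply, coface_X, map_add, apply_ite (setLastZero _), map_zero]
    simp [setLastZero, (Fin.le_last j).not_gt]
  | cast l =>
    simp only [AlgHom.comp_apply, coface_X, map_add, apply_ite (setLastZero _), map_zero]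
    simp [setLastZero, coface_X, ← Fin.castSucc_succ]

theorem setLastZero_coface_last {q : ℕ} (F : Cochain B m q) :
    setLastZero q (coface (Fin.last _) F) = F := by
  suffices H : (setLastZero q).comp (coface (B := B) (m := m) (Fin.last _)) =
      AlgHom.id _ _ from DFunLike.congr_fun H F
  refine MvPolynomial.algHom_ext fun v => ?_
  obtain ⟨l, c⟩ := v
  simp only [AlgHom.comp_apply, coface_X, map_add, apply_ite (setLastZero _), map_zero]
  induction l using Fin.lastCases with
  | last => simp [setLastZero, Fin.castSucc_lt_last]
  | cast l =>
    simp [setLastZero, Fin.castSucc_lt_last]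

/-- Cochains of positive degree that are allowed to depend on all the coordinates of the last
vector are acyclic. -/
theorem eq_diff_of_diff_eq_zero {q : ℕ} (F : Cochain B m (q + 1)) (hF : diff (q + 1) F = 0) :
    F = diff q ((-1 : ℤ) ^ (q + 1) • setLastZero q F) := by
  have h := congrArg (setLastZero (q + 1)) hF
  rw [diff_apply, Fin.sum_univ_castSucc, map_add, map_sum, map_zero] at h
  simp only [map_zsmul, setLastZero_coface_castSucc, setLastZero_coface_last, Fin.val_castSucc,
    ← diff_apply] at h
  rw [map_zsmul, eq_neg_of_add_eq_zero_left h, smul_neg, smul_smul, ← neg_smul]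
  have hs : -((-1 : ℤ) ^ (q + 1) * (-1) ^ (q + 2)) = 1 := by
    rw [pow_succ _ (q + 1), ← mul_assoc, ← pow_add, ← two_mul, pow_mul]
    simp
  simp only [Fin.val_last, hs, one_smul]

/-- In degree zero, the cocycles are the functions of the last vector that are invariant under
translations. -/
theorem exists_eq_C_of_diff_eq_zero (F : Cochain B m 0) (hF : diff 0 F = 0) :
    ∃ b, F = C b := by
  have h := congrArg (setLastZero 0) hF
  have h0 : ∀ G : Cochain B m 0, ∃ b, setLastZero 0 (coface 0 G) = C b := by
    intro G
    induction G using MvPolynomial.induction_on with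
    | C a => exact ⟨a, by simp⟩
    | add p q hp hq =>
      obtain ⟨a, ha⟩ := hp
      obtain ⟨b, hb⟩ := hq
      exact ⟨a + b, by simp [ha, hb]⟩
    | mul_X p v _ =>
      refine ⟨0, ?_⟩
      rw [map_mul, map_mul, coface_X]
      have : v.1.succ = Fin.last 1 := by ext; simp
      have h2 : setLastZero 0 (X (Fin.last 1, v.2) : Cochain B m 1) = 0 := by
        simp only [setLastZero, aeval_X, Fin.lastCases_last]
      rw [this, if_pos (Fin.zero_le _), map_add, h2, apply_ite (setLastZero 0)]
      simp
  rw [diff_apply, Fin.sum_univ_two, map_add, map_zero] at h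
  obtain ⟨b, hb⟩ := h0 F
  refine ⟨b, ?_⟩
  rw [← hb]
  have h1 := setLastZero_coface_last F
  simp only [Fin.val_zero, pow_zero, one_smul, Fin.val_one, pow_one, neg_smul, map_neg] at h
  rw [← sub_eq_add_neg, sub_eq_zero] at h
  exact (h.trans h1).symm

/-! ### Integration of polynomials -/

section Integral

variable {σ : Type*} [Algebra ℚ B]

/-- Every polynomial over a `ℚ`-algebra has an antiderivative in the variable `t` that is
independent of all other variables of which the polynomial is independent. -/
theorem exists_pderiv_eq (t : σ) (F : MvPolynomial σ B) :
    ∃ G, pderiv t G = F ∧ ∀ v ≠ t, pderiv v F = 0 → pderiv v G = 0 := by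
  classical
  let I : MvPolynomial σ B →ₗ[B] MvPolynomial σ B := (basisMonomials σ B).constr B
    fun u => monomial (u + Finsupp.single t 1) (algebraMap ℚ B (1 / ((u t : ℚ) + 1)))
  have hI : ∀ u, I (monomial u 1) =
      monomial (u + Finsupp.single t 1) (algebraMap ℚ B (1 / ((u t : ℚ) + 1))) := fun u => by
    have := (basisMonomials σ B).constr_basis B (fun u =>
      monomial (u + Finsupp.single t 1) (algebraMap ℚ B (1 / ((u t : ℚ) + 1)))) u
    rwa [coe_basisMonomials] at this
  refine ⟨I F, ?_, ?_⟩
  · suffices H : (pderiv t).toLinearMap ∘ₗ I = LinearMap.id from LinearMap.congr_fun H F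
    refine (basisMonomials σ B).ext fun u => ?_
    simp only [coe_basisMonomials, LinearMap.comp_apply, hI, LinearMap.id_apply]
    change pderiv t (monomial _ _) = _
    rw [pderiv_monomial]
    simp only [Finsupp.add_apply, Finsupp.single_eq_same, add_tsub_cancel_right]
    congr 1
    have : (u t : ℚ) + 1 ≠ 0 := by positivity
    rw [← map_natCast (algebraMap ℚ B), ← map_mul, Nat.cast_add, Nat.cast_one,
      one_div_mul_cancel this, map_one]
  · intro v hv h
    have H : (pderiv v).toLinearMap ∘ₗ I = I ∘ₗ (pderiv v).toLinearMap := by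
      refine (basisMonomials σ B).ext fun u => ?_
      simp only [coe_basisMonomials, LinearMap.comp_apply, hI]
      change pderiv v (monomial _ _) = I (pderiv v (monomial _ _))
      rw [pderiv_monomial, pderiv_monomial]
      have : monomial (u - Finsupp.single v 1) (1 * (u v : B)) =
          (u v : B) • monomial (u - Finsupp.single v 1) (1 : B) := by
        rw [smul_monomial]; simp
      rw [this, map_smul, hI, smul_monomial]
      by_cases h0 : u v = 0
      · simp [h0, hv]
      · have he : u + Finsupp.single t 1 - Finsupp.single v 1 =
            u - Finsupp.single v 1 + Finsupp.single t 1 := by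
          ext w
          simp only [Finsupp.coe_tsub, Finsupp.coe_add, Pi.sub_apply, Pi.add_apply,
            Finsupp.single_apply]
          split_ifs <;> grind
        rw [he]
        simp [hv, mul_comm]
    have := LinearMap.congr_fun H F
    change pderiv v (I F) = I (pderiv v F) at this
    rw [this, h, map_zero]

/-- A polynomial over a `ℚ`-algebra whose derivatives with respect to a set of variables vanish
is fixed by every substitution that only changes these variables. -/
theorem aeval_eq_self_of_pderiv_eq_zero (s : Set σ) (f : σ → MvPolynomial σ B)
    (hf : ∀ v ∉ s, f v = X v) (F : MvPolynomial σ B) (hF : ∀ v ∈ s, pderiv v F = 0) :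
    aeval f F = F := by
  classical
  have h0 : ∀ u ∈ F.support, ∀ v ∈ s, u v = 0 := by
    intro u hu v hv
    by_contra h
    have hc := congrArg (coeff (u - Finsupp.single v 1)) (hF v hv)
    have hle : Finsupp.single v 1 ≤ u := by
      rw [Finsupp.single_le_iff]
      exact Nat.one_le_iff_ne_zero.2 h
    rw [coeff_pderiv, tsub_add_cancel_of_le hle, coeff_zero] at hc
    have hne : (((u - Finsupp.single v 1 : σ →₀ ℕ) v : ℚ) + 1) ≠ 0 := by positivity
    refine mem_support_iff.1 hu ?_
    calc coeff u F = coeff u F * (((u - Finsupp.single v 1 : σ →₀ ℕ) v : B) + 1) *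
          algebraMap ℚ B (1 / (((u - Finsupp.single v 1 : σ →₀ ℕ) v : ℚ) + 1)) := by
          rw [mul_assoc, ← map_natCast (algebraMap ℚ B), ← map_one (algebraMap ℚ B), ← map_add,
            ← map_mul, mul_one_div_cancel hne, map_one, mul_one]
      _ = 0 := by rw [hc, zero_mul]
  conv_rhs => rw [F.as_sum]
  conv_lhs => rw [F.as_sum]
  rw [map_sum]
  refine Finset.sum_congr rfl fun u hu => ?_
  rw [aeval_monomial, monomial_eq]
  congr 1
  refine Finset.prod_congr rfl fun v hv => ?_
  change f v ^ u v = X v ^ u v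
  rw [hf v fun hvs => Finsupp.mem_support_iff.1 hv (h0 u hu v hvs)]

end Integral

/-! ### Cocycles that depend on some coordinates of the last vector only -/

/-- Differentiation with respect to the `t`-th coordinate of the last vector. -/
abbrev lastDeriv (q : ℕ) (t : Fin m) : Derivation B (Cochain B m q) (Cochain B m q) :=
  pderiv (Fin.last q, t)

theorem lastDeriv_comm {q : ℕ} (s t : Fin m) (F : Cochain B m q) :
    lastDeriv q s (lastDeriv q t F) = lastDeriv q t (lastDeriv q s F) := by
  classical
  have h : ⁅lastDeriv (B := B) q s, lastDeriv (B := B) q t⁆ = 0 := by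
    refine MvPolynomial.derivation_ext fun v => ?_
    simp only [Derivation.commutator_apply, pderiv_X, Derivation.coe_zero, Pi.zero_apply]
    simp [Pi.single_apply, apply_ite (pderiv _)]
  have := DFunLike.congr_fun h F
  rwa [Derivation.commutator_apply, Derivation.coe_zero, Pi.zero_apply, sub_eq_zero] at this

theorem lastDeriv_coface {q : ℕ} (t : Fin m) (j : Fin (q + 2)) (F : Cochain B m q) :
    lastDeriv (q + 1) t (coface j F) = coface j (lastDeriv q t F) := by
  classical
  have hX : ∀ v : Fin (q + 1) × Fin m, pderiv (Fin.last (q + 1), t) (coface (B := B) j (X v)) =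
      coface j (pderiv (Fin.last q, t) (X v)) := by
    rintro ⟨l, c⟩
    rw [coface_X, map_add]
    have h1 : pderiv (Fin.last (q + 1), t)
        (if l.castSucc < j then X (l.castSucc, c) else 0 : Cochain B m (q + 1)) = 0 := by
      split_ifs
      · rw [pderiv_X_of_ne]
        simp [(Fin.castSucc_lt_last l).ne]
      · simp
    rw [h1, zero_add]
    by_cases h : (l, c) = (Fin.last q, t)
    · obtain ⟨rfl, rfl⟩ := Prod.mk.inj h
      simp [Fin.le_last]
    · have h' : (l.succ, c) ≠ (Fin.last (q + 1), t) := by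
        simpa [← Fin.succ_last] using h
      rw [pderiv_X_of_ne h, map_zero]
      split_ifs
      · rw [pderiv_X_of_ne h']
      · simp
  simp only [lastDeriv]
  induction F using MvPolynomial.induction_on with
  | C a => simp
  | add p q hp hq => simp [hp, hq]
  | mul_X p v hp => rw [map_mul, Derivation.leibniz, Derivation.leibniz, hp, hX]; simp

theorem lastDeriv_diff {q : ℕ} (t : Fin m) (F : Cochain B m q) :
    lastDeriv (q + 1) t (diff q F) = diff q (lastDeriv q t F) := by
  simp only [diff_apply, lastDeriv, map_sum, map_zsmul]
  exact Finset.sum_congr rfl fun j _ => by rw [← lastDeriv_coface]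

/-- The polynomial cochains that depend on the last vector through its first `j` coordinates. -/
def activeSubmodule (B : Type*) [CommRing B] (m q j : ℕ) : Submodule B (Cochain B m q) where
  carrier := {F | ∀ t : Fin m, j ≤ t → lastDeriv q t F = 0}
  add_mem' hF hG t ht := by rw [map_add, hF t ht, hG t ht, add_zero]
  zero_mem' t _ := map_zero _
  smul_mem' b F hF t ht := by rw [Derivation.map_smul, hF t ht, smul_zero]

theorem diff_mem_activeSubmodule {q j : ℕ} {F : Cochain B m q}
    (hF : F ∈ activeSubmodule B m q j) : diff q F ∈ activeSubmodule B m (q + 1) j :=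
  fun t ht => by rw [lastDeriv_diff, hF t ht, map_zero]

/-- The monomial `ξ⁰_{c 0} ⋯ ξ^(q-1)_{c (q-1)}`. -/
def multilinearMonomial (B : Type*) [CommRing B] {q : ℕ} (c : Fin q → Fin m) : Cochain B m q :=
  ∏ l, X (l.castSucc, c l)

theorem lastDeriv_multilinearMonomial {q : ℕ} (c : Fin q → Fin m) (t : Fin m) :
    lastDeriv q t (multilinearMonomial B c) = 0 := by
  classical
  refine pderiv_eq_zero_of_notMem_vars fun h => ?_
  obtain ⟨l, -, hl⟩ := Finset.mem_biUnion.1 (vars_prod _ h)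
  rcases subsingleton_or_nontrivial B with _ | _
  · rw [Subsingleton.elim (X _) (0 : Cochain B m q), vars_0] at hl
    exact absurd hl (Finset.notMem_empty _)
  rw [vars_X, Finset.mem_singleton, Prod.mk.injEq] at hl
  exact (Fin.castSucc_lt_last l).ne hl.1.symm

/-- A coordinate of the last vector is not invariant under translations: only the last coface
adds a term to it, so multiplication with it commutes with the differential up to the cup product
with the corresponding linear cocycle. -/
theorem diff_X_last_mul {q : ℕ} (t : Fin m) (F : Cochain B m q) :
    diff q (X (Fin.last q, t) * F) = X (Fin.last (q + 1), t) * diff q F +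
      (-1 : ℤ) ^ (q + 1) • (X ((Fin.last q).castSucc, t) * coface (Fin.last _) F) := by
  simp only [diff_apply, Fin.sum_univ_castSucc (n := q + 1), map_mul, coface_X]
  simp only [mul_add, Finset.mul_sum, mul_smul_comm, add_assoc]
  congr 1
  · refine Finset.sum_congr rfl fun j _ => ?_
    have h1 : ¬ (Fin.last q).castSucc < j.castSucc := by
      simpa using Fin.le_last j
    have h2 : j.castSucc ≤ (Fin.last q).succ := by simp [Fin.le_last]
    rw [if_neg h1, if_pos h2, zero_add, Fin.succ_last]
  · simp [Fin.castSucc_lt_last, add_mul, smul_add, add_comm]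

theorem coface_last_multilinearMonomial {q : ℕ} (c : Fin q → Fin m) (t : Fin m) :
    X ((Fin.last q).castSucc, t) * coface (Fin.last _) (multilinearMonomial B c) =
      multilinearMonomial B (Fin.snoc c t : Fin (q + 1) → Fin m) := by
  rw [multilinearMonomial, multilinearMonomial, Fin.prod_univ_castSucc, map_prod, mul_comm]
  simp only [Fin.snoc_castSucc, Fin.snoc_last, coface_X]
  congr 1
  refine Finset.prod_congr rfl fun l _ => ?_
  have : ¬ Fin.last (q + 1) ≤ l.castSucc.succ := by
    rw [not_le, Fin.succ_castSucc]
    exact Fin.castSucc_lt_last _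
  simp [this, Fin.castSucc_lt_last]

/-- Each of these monomials is, up to a sign, the coboundary of the product of a coordinate of the
last vector with the monomial in one vector less. -/
theorem diff_multilinearMonomial {q : ℕ} (c : Fin q → Fin m) :
    diff q (multilinearMonomial B c) = 0 := by
  induction q with
  | zero => simp [multilinearMonomial, diff_apply, Fin.sum_univ_two]
  | succ q ih =>
    have h := diff_X_last_mul (c (Fin.last q)) (multilinearMonomial B (Fin.init c))
    rw [ih, mul_zero, zero_add, coface_last_multilinearMonomial, Fin.snoc_init_self] at h
    have h2 := congrArg (diff (q + 1)) h
    rw [diff_diff, map_zsmul] at h2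
    rcases neg_one_pow_eq_or ℤ (q + 1) with h3 | h3 <;> simpa [h3] using h2.symm

/-- The span of the monomials `ξ⁰_{c 0} ⋯ ξ^(q-1)_{c (q-1)}` with `c 0 > ⋯ > c (q-1) ≥ j`. -/
def normalForms (B : Type*) [CommRing B] (m q j : ℕ) : Submodule B (Cochain B m q) :=
  Submodule.span B {F | ∃ c : Fin q → Fin m, StrictAnti c ∧ (∀ l, j ≤ (c l : ℕ)) ∧
    multilinearMonomial B c = F}

theorem normalForms_mono {q i j : ℕ} (h : i ≤ j) : normalForms B m q j ≤ normalForms B m q i :=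
  Submodule.span_mono fun _ ⟨c, hc, hj, hF⟩ => ⟨c, hc, fun l => h.trans (hj l), hF⟩

theorem normalForms_le_activeSubmodule (q j i : ℕ) :
    normalForms B m q j ≤ activeSubmodule B m q i :=
  Submodule.span_le.2 fun _ ⟨c, _, _, hF⟩ t _ => hF ▸ lastDeriv_multilinearMonomial c t

theorem diff_eq_zero_of_mem_normalForms {q j : ℕ} {F : Cochain B m q}
    (hF : F ∈ normalForms B m q j) : diff q F = 0 := by
  have : normalForms B m q j ≤ LinearMap.ker (diff q) :=
    Submodule.span_le.2 <| by
      rintro _ ⟨c, _, _, rfl⟩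
      exact diff_multilinearMonomial c
  exact this hF

theorem diff_X_last_mul_mem_normalForms {q : ℕ} (t : Fin m) {F : Cochain B m q}
    (hF : F ∈ normalForms B m q (t + 1)) :
    diff q (X (Fin.last q, t) * F) ∈ normalForms B m (q + 1) t := by
  induction hF using Submodule.span_induction with
  | mem F hF =>
    obtain ⟨c, hc, hj, rfl⟩ := hF
    rw [diff_X_last_mul, diff_multilinearMonomial, mul_zero, zero_add,
      coface_last_multilinearMonomial]
    refine zsmul_mem (Submodule.subset_span (show _ ∈ {F | ∃ c : Fin (q + 1) → Fin m, _} from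
      ⟨_, ?_, ?_, rfl⟩)) _
    · intro a b hab
      induction b using Fin.lastCases with
      | last =>
        induction a using Fin.lastCases with
        | last => exact absurd hab (lt_irrefl _)
        | cast a =>
          simp only [Fin.snoc_castSucc, Fin.snoc_last]
          exact hj a
      | cast b =>
        induction a using Fin.lastCases with
        | last => exact absurd hab (Fin.castSucc_lt_last b).not_gt
        | cast a =>
          simp only [Fin.snoc_castSucc]
          exact hc (Fin.castSucc_lt_castSucc_iff.1 hab)
    · intro a
      induction a using Fin.lastCases with
      | last => simp
      | cast a => simpa using (Nat.le_succ _).trans (hj a)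
  | zero => simp
  | add F G _ _ hF hG => rw [mul_add, map_add]; exact add_mem hF hG
  | smul b F _ hF => rw [mul_smul_comm, map_smul]; exact Submodule.smul_mem _ _ hF

/-- The coboundaries of polynomial cochains that depend on the last vector through its first `j`
coordinates. -/
def activeCoboundaries (B : Type*) [CommRing B] (m j : ℕ) :
    (q : ℕ) → Submodule B (Cochain B m q)
  | 0 => ⊥
  | q + 1 => (activeSubmodule B m q j).map (diff q)

/-- The cohomology of the polynomial cochains depending on the last vector through its first `j`
coordinates is spanned by the normal forms in the remaining directions.  The
proof is a descending induction on `j`: passing from `j + 1` to `j`, the obstruction to finding a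
primitive that does not depend on the coordinate `j` is a cocycle of lower degree, namely the
derivative of the primitive with respect to this coordinate. -/
theorem mem_normalForms_sup_activeCoboundaries [Algebra ℚ B] {q j : ℕ} (hj : j ≤ m)
    (F : Cochain B m q) (hF : F ∈ activeSubmodule B m q j) (hd : diff q F = 0) :
    F ∈ normalForms B m q j ⊔ activeCoboundaries B m j q := by
  induction hj using Nat.decreasingInduction generalizing q with
  | self =>
    cases q with
    | zero =>
      obtain ⟨b, rfl⟩ := exists_eq_C_of_diff_eq_zero F hd
      refine Submodule.mem_sup_left ?_
      have : (C b : Cochain B m 0) = b • multilinearMonomial B Fin.elim0 := by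
        simp [multilinearMonomial, smul_eq_C_mul]
      rw [this]
      exact Submodule.smul_mem _ _ (Submodule.subset_span
        ⟨_, fun a => a.elim0, fun a => a.elim0, rfl⟩)
    | succ q =>
      rw [eq_diff_of_diff_eq_zero F hd]
      exact Submodule.mem_sup_right ⟨_, fun t ht => absurd t.2 (not_lt.2 ht), rfl⟩
  | of_succ j hjm ih =>
    let t : Fin m := ⟨j, hjm⟩
    obtain ⟨E, hE, F', hF', rfl⟩ := Submodule.mem_sup.1
      (ih F (fun s hs => hF s ((Nat.le_succ j).trans hs)) hd)
    cases q with
    | zero =>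
      rw [(Submodule.mem_bot B).1 hF', add_zero]
      exact Submodule.mem_sup_left (normalForms_mono (Nat.le_succ j) hE)
    | succ q =>
      obtain ⟨G, hG, rfl⟩ := hF'
      have hGt : diff q (lastDeriv q t G) = 0 := by
        rw [← lastDeriv_diff]
        have h1 := hF t le_rfl
        rwa [map_add, normalForms_le_activeSubmodule _ _ 0 hE t (Nat.zero_le _),
          zero_add] at h1
      have hGt' : lastDeriv q t G ∈ activeSubmodule B m q (j + 1) := fun s hs => by
        rw [lastDeriv_comm, hG s hs, map_zero]
      obtain ⟨E', hE', F', hF', hsum⟩ := Submodule.mem_sup.1 (ih _ hGt' hGt)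
      -- an antiderivative of the coboundary `F'` that is a coboundary itself, obtained by
      -- integrating a primitive of `F'`
      obtain ⟨H, hHt, hHs, hH⟩ : ∃ H : Cochain B m q, lastDeriv q t H = F' ∧
          H ∈ activeSubmodule B m q (j + 1) ∧ diff q H = 0 := by
        cases q with
        | zero => exact ⟨0, by simpa using ((Submodule.mem_bot B).1 hF').symm, zero_mem _, by simp⟩
        | succ q =>
          obtain ⟨K, hK, rfl⟩ := hF'
          obtain ⟨L, hL, hLs⟩ := exists_pderiv_eq (Fin.last q, t) K
          refine ⟨diff q L, ?_, diff_mem_activeSubmodule fun s hs => hLs _ ?_ (hK s hs),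
            diff_diff L⟩
          · rw [lastDeriv_diff, hL]
          · exact fun h => (Nat.lt_of_succ_le hs).ne' (congrArg Fin.val (Prod.mk.inj h).2)
      have hX : ∀ s, lastDeriv q s (X (Fin.last q, t) * E') =
          if s = t then E' else 0 := fun s => by
        rw [Derivation.leibniz, normalForms_le_activeSubmodule _ _ 0 hE' s
          (Nat.zero_le _), smul_zero, zero_add]
        split_ifs with h
        · subst h; rw [pderiv_X_self, smul_eq_mul, mul_one]
        · rw [pderiv_X_of_ne (by simpa using Ne.symm h), smul_zero]
      refine Submodule.mem_sup.2 ⟨E + diff q (X (Fin.last q, t) * E'),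
        add_mem (normalForms_mono (Nat.le_succ j) hE) (diff_X_last_mul_mem_normalForms t hE'),
        diff q (G - H - X (Fin.last q, t) * E'), ⟨_, fun s hs => ?_, rfl⟩, ?_⟩
      · rcases hs.eq_or_lt with h | h
        · obtain rfl : s = t := Fin.ext h.symm
          have h2 := hX t
          rw [if_pos rfl] at h2
          rw [map_sub, map_sub, h2, hHt, ← hsum]
          abel
        · have hst : s ≠ t := fun h' => by
            subst h'; exact lt_irrefl _ h
          have h2 := hX s
          rw [if_neg hst] at h2
          rw [map_sub, map_sub, h2, hHs s h, hG s h, sub_zero, sub_zero]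
      · rw [map_sub, map_sub, hH]
        abel

end PolyCobar

/-! ### Partial derivatives -/

section Partial

variable (𝕜 : Type*) [RCLike 𝕜] {m n k : ℕ}

theorem iteratedPartial_zero : iteratedPartial 𝕜 n 0 = 1 := by
  simp [iteratedPartial]

theorem iteratedPartial_add_single (I : Fin n → ℕ) (i : Fin n) :
    iteratedPartial 𝕜 n (I + Pi.single i 1) = partialDeriv 𝕜 n i * iteratedPartial 𝕜 n I :=
  (prod_ofFn_pow_add_single _ (partialDeriv_comm 𝕜) I i).symm

theorem multiindex_induction {P : (Fin n → ℕ) → Prop} (h0 : P 0)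
    (h1 : ∀ I i, P I → P (I + Pi.single i 1)) (I : Fin n → ℕ) : P I := by
  induction hN : ∑ i, I i generalizing I with
  | zero =>
    have : I = 0 := funext fun i => (Finset.sum_eq_zero_iff.1 hN) i (Finset.mem_univ i)
    exact this ▸ h0
  | succ N ih =>
    obtain ⟨i, -, hi⟩ := Finset.exists_ne_zero_of_sum_ne_zero (hN.trans_ne N.succ_ne_zero)
    have hI : I = I - Pi.single i 1 + Pi.single i 1 := by
      refine (tsub_add_cancel_of_le fun j => ?_).symm
      rcases eq_or_ne j i with rfl | h
      · simpa using Nat.one_le_iff_ne_zero.2 hi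
      · simp [h]
    rw [hI] at hN ⊢
    refine h1 _ _ (ih _ ?_)
    simpa [Finset.sum_add_distrib] using hN

theorem commute_partialDeriv_iteratedPartial (i : Fin n) (I : Fin n → ℕ) :
    Commute (partialDeriv 𝕜 n i) (iteratedPartial 𝕜 n I) := by
  induction I using multiindex_induction with
  | h0 => rw [iteratedPartial_zero]; exact Commute.one_right _
  | h1 I j ih => rw [iteratedPartial_add_single]; exact (partialDeriv_comm 𝕜 i j).mul_right ih

theorem iteratedPartial_add (I J : Fin n → ℕ) :
    iteratedPartial 𝕜 n (I + J) = iteratedPartial 𝕜 n I * iteratedPartial 𝕜 n J := by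
  induction J using multiindex_induction with
  | h0 => rw [iteratedPartial_zero, add_zero, mul_one]
  | h1 J j ih =>
    rw [← add_assoc, iteratedPartial_add_single, iteratedPartial_add_single, ih, ← mul_assoc,
      ← mul_assoc, (commute_partialDeriv_iteratedPartial 𝕜 j I).eq]

variable {𝕜}

/-- The projection on the first `k` coordinates as a continuous linear map. -/
def coordProjCLM (m : ℕ) (hkn : k ≤ n) : (Fin n → ℝ) →L[ℝ] (Fin m → ℝ) :=
  LinearMap.toContinuousLinearMap
    { toFun := coordProj m hkn
      map_add' := fun x y => by
        funext i
        by_cases h : (i : ℕ) < k <;> simp [coordProj, h]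
      map_smul' := fun c x => by
        funext i
        by_cases h : (i : ℕ) < k <;> simp [coordProj, h] }

theorem partialDeriv_coordProjPullback (hkn : k ≤ n) (i : Fin n) (a : SmoothFun 𝕜 m)
    (v : Fin m → ℝ) (hv : coordProj m hkn (Pi.single i 1) = v) (x : Fin n → ℝ) :
    (partialDeriv 𝕜 n i (coordProjPullback 𝕜 m hkn a)).1 x =
      fderiv ℝ a.1 (coordProj m hkn x) v := by
  change fderiv ℝ (a.1 ∘ coordProjCLM m hkn) x (Pi.single i 1) = _
  rw [fderiv_comp x (a.differentiable _) (coordProjCLM m hkn).differentiableAt,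
    ContinuousLinearMap.fderiv, ← hv]
  rfl

theorem partialDeriv_coordProjPullback_of_lt (hkm : k ≤ m) (hkn : k ≤ n) (i : Fin n)
    (hi : (i : ℕ) < k) (a : SmoothFun 𝕜 m) :
    partialDeriv 𝕜 n i (coordProjPullback 𝕜 m hkn a) =
      coordProjPullback 𝕜 m hkn (partialDeriv 𝕜 m ⟨i, hi.trans_le hkm⟩ a) := by
  refine SmoothFun.ext fun x => partialDeriv_coordProjPullback hkn i a _ ?_ x
  funext j
  by_cases h : (j : ℕ) < k
  · simp [coordProj, h, Pi.single_apply, Fin.ext_iff]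
  · have : (j : ℕ) ≠ i := fun h' => h (h' ▸ hi)
    simp [coordProj, h, Fin.ext_iff, this]

theorem partialDeriv_coordProjPullback_of_le (hkn : k ≤ n) (i : Fin n)
    (hi : k ≤ (i : ℕ)) (a : SmoothFun 𝕜 m) :
    partialDeriv 𝕜 n i (coordProjPullback 𝕜 m hkn a) = 0 := by
  refine SmoothFun.ext fun x => (partialDeriv_coordProjPullback hkn i a 0 ?_ x).trans (map_zero _)
  funext j
  by_cases h : (j : ℕ) < k
  · have : (j : ℕ) ≠ i := fun h' => by omega
    simp [coordProj, h, Fin.ext_iff, this]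
  · simp [coordProj, h]

end Partial

/-! ### Symbols of vertical operators -/

section Symbol

open MvPolynomial

variable (𝕜 : Type*) [RCLike 𝕜] (m : ℕ) {n k : ℕ}

/-- Symbols of vertical operators: polynomials over `C^∞(ℝⁿ)` in one variable for each coordinate
after the `k`-th one. -/
abbrev VerSymbol (n k : ℕ) : Type _ := MvPolynomial {i : Fin n // k ≤ (i : ℕ)} (SmoothFun 𝕜 n)

/-- Extension by zero of a multiindex in the coordinates after the `k`-th one. -/
def verIndex (v : {i : Fin n // k ≤ (i : ℕ)} →₀ ℕ) : Fin n → ℕ :=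
  fun i => if h : k ≤ (i : ℕ) then v ⟨i, h⟩ else 0

/-- The vertical operator with a given symbol. -/
def verOp : VerSymbol 𝕜 n k →ₗ[SmoothFun 𝕜 n] Module.End 𝕜 (SmoothFun 𝕜 n) :=
  (basisMonomials _ (SmoothFun 𝕜 n)).constr (SmoothFun 𝕜 n)
    fun v => iteratedPartial 𝕜 n (verIndex v)

theorem verOp_monomial (v : {i : Fin n // k ≤ (i : ℕ)} →₀ ℕ) (r : SmoothFun 𝕜 n) :
    verOp 𝕜 (monomial v r) = r • iteratedPartial 𝕜 n (verIndex v) := by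
  have h := (basisMonomials _ (SmoothFun 𝕜 n)).constr_basis (SmoothFun 𝕜 n)
    (fun v : {i : Fin n // k ≤ (i : ℕ)} →₀ ℕ => iteratedPartial 𝕜 n (verIndex v)) v
  rw [coe_basisMonomials] at h
  rw [← mul_one r, ← smul_eq_mul, ← smul_monomial, map_smul]
  exact congrArg₂ _ (by simp) h

theorem verOp_C (r : SmoothFun 𝕜 n) : verOp 𝕜 (k := k) (C r) = mulOperator 𝕜 r := by
  have : verIndex (0 : {i : Fin n // k ≤ (i : ℕ)} →₀ ℕ) = 0 := by
    funext i
    simp [verIndex]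
  rw [C_apply, verOp_monomial, this, iteratedPartial_zero]
  rfl

theorem verOp_mul_X (b : VerSymbol 𝕜 n k) (i : {i : Fin n // k ≤ (i : ℕ)}) :
    verOp 𝕜 (b * X i) = verOp 𝕜 b * partialDeriv 𝕜 n i := by
  induction b using MvPolynomial.induction_on' with
  | monomial v r =>
    have h : verIndex (v + Finsupp.single i 1) = verIndex v + Pi.single i.1 1 := by
      funext j
      by_cases hj : k ≤ (j : ℕ)
      · by_cases hij : i = ⟨j, hj⟩
        · subst hij; simp [verIndex, hj]
        · have : j ≠ i.1 := fun h => hij (Subtype.ext h.symm)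
          simp [verIndex, hj, hij, this]
      · have : j ≠ i.1 := fun h => hj (h ▸ i.2)
        simp [verIndex, hj, this]
    rw [X, monomial_mul, mul_one, verOp_monomial, verOp_monomial, h, iteratedPartial_add_single,
      (commute_partialDeriv_iteratedPartial 𝕜 _ _).eq, smul_mul_assoc]
  | add b c hb hc => rw [add_mul, map_add, map_add, hb, hc, add_mul]

/-- Vertical operators are linear over the functions pulled back along the projection. -/
theorem verOp_coordProjPullback_mul (hkn : k ≤ n) (b : VerSymbol 𝕜 n k) (a : SmoothFun 𝕜 m)
    (f : SmoothFun 𝕜 n) : verOp 𝕜 b (coordProjPullback 𝕜 m hkn a * f) =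
      coordProjPullback 𝕜 m hkn a * verOp 𝕜 b f := by
  induction b using MvPolynomial.induction_on generalizing f with
  | C r =>
    rw [verOp_C]
    change r * (_ * f) = _ * (r * f)
    ring
  | add b c hb hc => simp only [map_add, LinearMap.add_apply, hb, hc, mul_add]
  | mul_X b i hb =>
    rw [verOp_mul_X, Module.End.mul_apply, Module.End.mul_apply, partialDeriv_mul,
      partialDeriv_coordProjPullback_of_le hkn i.1 i.2, zero_mul, add_zero, hb]

theorem verOp_mul_mem_diffOp (b : VerSymbol 𝕜 n k) {D : Module.End 𝕜 (SmoothFun 𝕜 n)}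
    (hD : D ∈ DiffOp 𝕜 n) : verOp 𝕜 b * D ∈ DiffOp 𝕜 n := by
  induction b using MvPolynomial.induction_on' with
  | monomial v r =>
    rw [verOp_monomial, smul_mul_assoc]
    exact Submodule.smul_mem _ _ (iteratedPartial_mul_mem_diffOp 𝕜 _ hD)
  | add b c hb hc => rw [map_add, add_mul]; exact add_mem hb hc

theorem range_verOp : LinearMap.range (verOp 𝕜 (n := n) (k := k)) =
    Submodule.span (SmoothFun 𝕜 n)
      (iteratedPartial 𝕜 n '' {I | ∀ i : Fin n, (i : ℕ) < k → I i = 0}) := by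
  rw [verOp, Module.Basis.constr_range]
  congr 1
  ext D
  constructor
  · rintro ⟨v, rfl⟩
    exact ⟨_, fun i hi => dif_neg (not_le.2 hi), rfl⟩
  · rintro ⟨I, hI, rfl⟩
    refine ⟨Finsupp.equivFunOnFinite.symm fun i => I i.1, congrArg _ (funext fun i => ?_)⟩
    by_cases h : k ≤ (i : ℕ)
    · simp [verIndex, h]
    · simp [verIndex, h, hI i (not_le.1 h)]

end Symbol

/-! ### Differential cochains and their symbols -/

section SymbolCochain

open MvPolynomial PolyCobar

variable {𝕜 : Type*} [RCLike 𝕜] {m n k q : ℕ}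

/-- The cochain `(a₁, …, a_q) ↦ (∂^{I₁} a₁ ⋯ ∂^{I_q} a_q) · ψ`. -/
def pureCochain {M : Type*} [AddCommGroup M] [Module 𝕜 M] [Module (SmoothFun 𝕜 m) M]
    [IsScalarTower 𝕜 (SmoothFun 𝕜 m) M] (I : Fin q → Fin m → ℕ) :
    M →ₗ[SmoothFun 𝕜 m] HochschildCochain 𝕜 (SmoothFun 𝕜 m) M q where
  toFun ψ := ((LinearMap.toSpanSingleton (SmoothFun 𝕜 m) M ψ).restrictScalars 𝕜).compMultilinearMap
    ((MultilinearMap.mkPiAlgebra 𝕜 (Fin q) (SmoothFun 𝕜 m)).compLinearMap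
      fun j => iteratedPartial 𝕜 m (I j))
  map_add' ψ φ := by ext a; simp
  map_smul' c ψ := by
    ext a
    simp [smul_smul, mul_comm]

theorem pureCochain_apply {M : Type*} [AddCommGroup M] [Module 𝕜 M] [Module (SmoothFun 𝕜 m) M]
    [IsScalarTower 𝕜 (SmoothFun 𝕜 m) M] (I : Fin q → Fin m → ℕ) (ψ : M)
    (a : Fin q → SmoothFun 𝕜 m) :
    pureCochain (𝕜 := 𝕜) I ψ a = (∏ j, iteratedPartial 𝕜 m (I j) (a j)) • ψ := by
  simp [pureCochain]

/-- The multiindices of the derivatives that the monomial with exponents `u` applies to the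
arguments of a cochain. -/
def argIndex (u : Fin (q + 1) × Fin m →₀ ℕ) : Fin q → Fin m → ℕ := fun l i => u (l.castSucc, i)

/-- The multiindex of the derivatives along the first `k` coordinates in the value of a cochain
that belongs to the monomial with exponents `u`. -/
def baseIndex (n : ℕ) (hkm : k ≤ m) (u : Fin (q + 1) × Fin m →₀ ℕ) : Fin n → ℕ :=
  fun i => if h : (i : ℕ) < k then u (Fin.last q, ⟨i, h.trans_le hkm⟩) else 0

/-- The derivative by which the `i`-th coordinate of the last vector acts on functions. -/
def baseDeriv (𝕜 : Type*) [RCLike 𝕜] (hkn : k ≤ n) (i : Fin m) : Module.End 𝕜 (SmoothFun 𝕜 n) :=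
  if h : (i : ℕ) < k then partialDeriv 𝕜 n ⟨i, h.trans_le hkn⟩ else 1

variable (hkm : k ≤ m) (hkn : k ≤ n)

theorem diffOpAlong_add_apply {p : SmoothFun 𝕜 m →ₐ[𝕜] SmoothFun 𝕜 n} (D E : DiffOpAlong p)
    (f : SmoothFun 𝕜 n) : (D + E).1 f = D.1 f + E.1 f := rfl

theorem iteratedPartial_mem_diffOp (I : Fin n → ℕ) : iteratedPartial 𝕜 n I ∈ DiffOp 𝕜 n :=
  Submodule.subset_span ⟨I, rfl⟩

/-- The differential operator with vertical symbol `b`, precomposed with the derivatives along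
the first `k` coordinates that belong to the monomial with exponents `u`. -/
def symbolValue (u : Fin (q + 1) × Fin m →₀ ℕ) :
    VerSymbol 𝕜 n k →+ DiffOpAlong (coordProjPullback 𝕜 m hkn) where
  toFun b := (⟨verOp 𝕜 b * iteratedPartial 𝕜 n (baseIndex n hkm u),
    verOp_mul_mem_diffOp 𝕜 b (iteratedPartial_mem_diffOp _)⟩ : DiffOp 𝕜 n)
  map_zero' := Subtype.ext <|
    (congrArg (· * iteratedPartial 𝕜 n (baseIndex n hkm u)) (map_zero (verOp 𝕜))).trans (zero_mul _)
  map_add' b c := Subtype.ext <|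
    (congrArg (· * iteratedPartial 𝕜 n (baseIndex n hkm u)) (map_add (verOp 𝕜) b c)).trans
      (add_mul _ _ _)

/-- The differential cochain with a given symbol: the variable `ξˡ_i` with `l < q` differentiates
the `l`-th argument with respect to the `i`-th coordinate, the `i`-th coordinate of the last vector
with `i < k` and the variables of the coefficients differentiate the function to which the value of
the cochain is applied.  The coordinates `i ≥ k` of the last vector are ignored. -/
def symbolCochain : Cochain (VerSymbol 𝕜 n k) m q →+
    HochschildCochain 𝕜 (SmoothFun 𝕜 m) (DiffOpAlong (coordProjPullback 𝕜 m hkn)) q :=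
  (Finsupp.liftAddHom fun u => (pureCochain (𝕜 := 𝕜) (argIndex u)).toAddMonoidHom.comp
    (symbolValue hkm hkn u)).comp AddMonoidAlgebra.coeffAddEquiv.toAddMonoidHom

theorem symbolCochain_monomial (u : Fin (q + 1) × Fin m →₀ ℕ) (b : VerSymbol 𝕜 n k) :
    symbolCochain hkm hkn (monomial u b) =
      pureCochain (𝕜 := 𝕜) (argIndex u) (symbolValue hkm hkn u b) := by
  refine (Finsupp.liftAddHom_apply_single (fun u =>
    (pureCochain (𝕜 := 𝕜) (argIndex u)).toAddMonoidHom.comp (symbolValue hkm hkn u)) u b).trans rfl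

theorem symbolCochain_monomial_apply (u : Fin (q + 1) × Fin m →₀ ℕ) (b : VerSymbol 𝕜 n k)
    (a : Fin q → SmoothFun 𝕜 m) (f : SmoothFun 𝕜 n) :
    (symbolCochain hkm hkn (monomial u b) a).1 f =
      coordProjPullback 𝕜 m hkn (∏ l, iteratedPartial 𝕜 m (argIndex u l) (a l)) *
        verOp 𝕜 b (iteratedPartial 𝕜 n (baseIndex n hkm u) f) := by
  rw [symbolCochain_monomial, pureCochain_apply]
  rfl

theorem symbolCochain_C_apply (b : VerSymbol 𝕜 n k) (a : Fin q → SmoothFun 𝕜 m)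
    (f : SmoothFun 𝕜 n) : (symbolCochain hkm hkn (C b) a).1 f =
      coordProjPullback 𝕜 m hkn (∏ l, a l) * verOp 𝕜 b f := by
  have h1 : baseIndex n hkm (0 : Fin (q + 1) × Fin m →₀ ℕ) = 0 := by
    funext i; simp [baseIndex]
  have h2 : ∀ l, argIndex (0 : Fin (q + 1) × Fin m →₀ ℕ) l = 0 := fun l => by
    funext i; simp [argIndex]
  rw [C_apply, symbolCochain_monomial_apply, h1]
  simp only [h2, iteratedPartial_zero, Module.End.one_apply]

/-- Together with `symbolCochain_C_apply` and `symbolCochain_mul_X_last_apply`, this determines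
`symbolCochain` by recursion, so that the compatibility with the faces can be checked one
derivative at a time. -/
theorem symbolCochain_mul_X_castSucc (F : Cochain (VerSymbol 𝕜 n k) m q) (l : Fin q) (i : Fin m)
    (a : Fin q → SmoothFun 𝕜 m) :
    symbolCochain hkm hkn (F * X (l.castSucc, i)) a =
      symbolCochain hkm hkn F (Function.update a l (partialDeriv 𝕜 m i (a l))) := by
  induction F using MvPolynomial.induction_on' with
  | monomial u b =>
    refine Subtype.ext (LinearMap.ext fun f => ?_)
    rw [X, monomial_mul, mul_one, symbolCochain_monomial_apply, symbolCochain_monomial_apply]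
    have h1 : baseIndex n hkm (u + Finsupp.single (l.castSucc, i) 1) = baseIndex n hkm u := by
      funext j
      simp [baseIndex, (Fin.castSucc_lt_last l).ne]
    rw [h1]
    refine congrArg (fun x => coordProjPullback 𝕜 m hkn x * _)
      (Finset.prod_congr rfl fun l' _ => ?_)
    rcases eq_or_ne l' l with rfl | h
    · have h2 : argIndex (u + Finsupp.single (l'.castSucc, i) 1) l' =
          argIndex u l' + Pi.single i 1 := by
        funext j
        simp [argIndex, Finsupp.single_apply, Pi.single_apply, eq_comm]
      rw [h2, iteratedPartial_add_single, Function.update_self,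
        (commute_partialDeriv_iteratedPartial 𝕜 _ _).eq]
      rfl
    · have h2 : argIndex (u + Finsupp.single (l.castSucc, i) 1) l' = argIndex u l' := by
        funext j
        simp [argIndex, h.symm]
      rw [h2, Function.update_of_ne h]
  | add F G hF hG => rw [add_mul, map_add, map_add, add_apply, add_apply, hF, hG]

theorem symbolCochain_mul_X_last_apply (F : Cochain (VerSymbol 𝕜 n k) m q) (i : Fin m)
    (a : Fin q → SmoothFun 𝕜 m) (f : SmoothFun 𝕜 n) :
    (symbolCochain hkm hkn (F * X (Fin.last q, i)) a).1 f =
      (symbolCochain hkm hkn F a).1 (baseDeriv 𝕜 hkn i f) := by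
  induction F using MvPolynomial.induction_on' with
  | monomial u b =>
    rw [X, monomial_mul, mul_one, symbolCochain_monomial_apply, symbolCochain_monomial_apply]
    have h1 : ∀ l, argIndex (u + Finsupp.single (Fin.last q, i) 1) l = argIndex u l := by
      intro l
      funext j
      simp [argIndex]
    simp only [h1]
    congr 2
    by_cases h : (i : ℕ) < k
    · have h2 : baseIndex n hkm (u + Finsupp.single (Fin.last q, i) 1) =
          baseIndex n hkm u + Pi.single ⟨i, h.trans_le hkn⟩ 1 := by
        funext j
        by_cases hj : (j : ℕ) < k
        · simp [baseIndex, hj, Finsupp.single_apply, Pi.single_apply, Fin.ext_iff, eq_comm]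
        · have : (j : ℕ) ≠ i := fun h' => hj (h' ▸ h)
          simp [baseIndex, hj, Fin.ext_iff, this]
      rw [h2, iteratedPartial_add_single, baseDeriv, dif_pos h,
        (commute_partialDeriv_iteratedPartial 𝕜 _ _).eq]
      rfl
    · have h2 : baseIndex n hkm (u + Finsupp.single (Fin.last q, i) 1) = baseIndex n hkm u := by
        funext j
        by_cases hj : (j : ℕ) < k
        · have : (i : ℕ) ≠ j := fun h' => h (h' ▸ hj)
          simp [baseIndex, hj, Fin.ext_iff, this]
        · simp [baseIndex, hj]
      rw [h2, baseDeriv, dif_neg h]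
      rfl
  | add F G hF hG =>
    rw [add_mul, map_add, map_add]
    exact congrArg₂ (· + ·) hF hG

theorem symbolCochain_mem_diffCochain (F : Cochain (VerSymbol 𝕜 n k) m q) :
    symbolCochain hkm hkn F ∈
      diffCochain 𝕜 m (DiffOpAlong (coordProjPullback 𝕜 m hkn)) q := by
  induction F using MvPolynomial.induction_on' with
  | monomial u b =>
    rw [symbolCochain_monomial]
    exact Submodule.subset_span ⟨_, _, pureCochain_apply _ _⟩
  | add F G hF hG => rw [map_add]; exact add_mem hF hG

/-! ### Compatibility of the symbols with the differentials -/

theorem hochschildFirstFace_symbolCochain (F : Cochain (VerSymbol 𝕜 n k) m q) :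
    hochschildFirstFace (symbolCochain hkm hkn F) = symbolCochain hkm hkn (coface 0 F) := by
  induction F using MvPolynomial.induction_on with
  | C b =>
    ext1 a
    refine Subtype.ext (LinearMap.ext fun f => ?_)
    rw [hochschildFirstFace_apply, DiffOpAlong.left_smul_apply, symbolCochain_C_apply,
      show coface 0 (C b) = C b from (coface 0).commutes b, symbolCochain_C_apply, ← mul_assoc,
      ← _root_.map_mul, Fin.prod_univ_succ]
    rfl
  | add F G hF hG =>
    rw [map_add, map_add, map_add, ← hF, ← hG]
    ext1 a
    simp only [hochschildFirstFace_apply, add_apply, smul_add]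
  | mul_X F v hF =>
    obtain ⟨l, i⟩ := v
    ext1 a
    rw [map_mul (coface _), coface_X, if_neg (Fin.not_lt_zero _), if_pos (Fin.zero_le _), zero_add,
      hochschildFirstFace_apply]
    induction l using Fin.lastCases with
    | cast l =>
      rw [Fin.succ_castSucc, symbolCochain_mul_X_castSucc, symbolCochain_mul_X_castSucc, ← hF,
        hochschildFirstFace_apply, Fin.tail_update_succ,
        Function.update_of_ne (Fin.succ_ne_zero l).symm]
      rfl
    | last =>
      refine Subtype.ext (LinearMap.ext fun f => ?_)
      rw [Fin.succ_last, symbolCochain_mul_X_last_apply, ← hF, DiffOpAlong.left_smul_apply,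
        symbolCochain_mul_X_last_apply]
      rfl

/-- The inner faces correspond to `ξ^j ↦ ξ^j + ξ^(j+1)` by the Leibniz rule for
`∂_i (a_j a_{j+1})`. -/
theorem hochschildInnerFace_symbolCochain (j : Fin q) (F : Cochain (VerSymbol 𝕜 n k) m q) :
    hochschildInnerFace j (symbolCochain hkm hkn F) =
      symbolCochain hkm hkn (coface j.succ.castSucc F) := by
  induction F using MvPolynomial.induction_on with
  | C b =>
    ext1 a
    refine Subtype.ext (LinearMap.ext fun f => ?_)
    rw [hochschildInnerFace_apply, symbolCochain_C_apply,
      show coface _ (C b) = C b from (coface _).commutes b, symbolCochain_C_apply]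
    have h := congrFun (Fin.partialProd_contractNth a j.castSucc) (Fin.last q)
    rw [Function.comp_apply, Fin.succ_castSucc,
      Fin.succAbove_ne_last_last (Fin.castSucc_lt_last j.succ).ne] at h
    rw [Fin.partialProd, Fin.partialProd] at h
    simpa [List.take_of_length_le, List.prod_ofFn, Fin.prod_univ_succ] using congrArg
      (fun x => coordProjPullback 𝕜 m hkn x * verOp 𝕜 b f) h
  | add F G hF hG =>
    rw [map_add, map_add, map_add, ← hF, ← hG]
    ext1 a
    simp only [hochschildInnerFace_apply, add_apply]
  | mul_X F v hF =>
    obtain ⟨l, i⟩ := v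
    ext1 a
    rw [map_mul (coface _), coface_X, hochschildInnerFace_apply]
    induction l using Fin.lastCases with
    | cast l =>
      rw [symbolCochain_mul_X_castSucc]
      rcases lt_trichotomy l j with h | rfl | h
      · have h1 : l.castSucc.castSucc < j.succ.castSucc := by
          rw [Fin.lt_def] at h ⊢; simp only [Fin.val_castSucc, Fin.val_succ]; omega
        have h2 : ¬ j.succ.castSucc ≤ l.castSucc.succ := by
          rw [Fin.lt_def] at h
          rw [Fin.le_def]; simp only [Fin.val_castSucc, Fin.val_succ]; omega
        have h3 : l.castSucc ≠ j.castSucc := fun e => h.ne (Fin.castSucc_injective _ e)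
        have h4 : l.castSucc ≠ j.succ := fun e => by
          rw [Fin.ext_iff, Fin.val_castSucc, Fin.val_succ] at e; omega
        rw [if_pos h1, if_neg h2, add_zero, symbolCochain_mul_X_castSucc, ← hF,
          hochschildInnerFace_apply, contractNth_update, if_neg h3, if_neg h4, one_mul,
          Fin.predAbove_castSucc_of_le _ _ h.le, Fin.contractNth_apply_of_lt _ _ _ _ h]
      · have h1 : l.castSucc.castSucc < l.succ.castSucc := by
          simp [Fin.lt_def]
        have h2 : l.succ.castSucc ≤ l.castSucc.succ := le_rfl
        rw [if_pos h1, if_pos h2, mul_add, map_add, add_apply, Fin.succ_castSucc,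
          symbolCochain_mul_X_castSucc, symbolCochain_mul_X_castSucc, ← hF,
          hochschildInnerFace_apply, hochschildInnerFace_apply, contractNth_update,
          contractNth_update, if_pos rfl, if_neg (Fin.castSucc_lt_succ (i := l)).ne', if_pos rfl,
          Fin.predAbove_castSucc_self, Fin.predAbove_succ_self,
          Fin.contractNth_apply_of_eq _ _ _ _ rfl, ← MultilinearMap.map_update_add,
          partialDeriv_mul, mul_comm (a l.succ), add_comm (a l.castSucc * _)]
      · have h1 : ¬ l.castSucc.castSucc < j.succ.castSucc := by
          rw [Fin.lt_def] at h ⊢; simp only [Fin.val_castSucc, Fin.val_succ]; omega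
        have h2 : j.succ.castSucc ≤ l.castSucc.succ := by
          rw [Fin.lt_def] at h
          rw [Fin.le_def]; simp only [Fin.val_castSucc, Fin.val_succ]; omega
        have h3 : l.succ ≠ j.castSucc := fun e => by
          rw [Fin.ext_iff, Fin.val_castSucc, Fin.val_succ] at e; omega
        have h4 : l.succ ≠ j.succ := fun e => h.ne' (Fin.succ_injective _ e)
        rw [if_neg h1, if_pos h2, zero_add, Fin.succ_castSucc, symbolCochain_mul_X_castSucc, ← hF,
          hochschildInnerFace_apply, contractNth_update, if_neg h3, if_neg h4, one_mul,
          Fin.predAbove_succ_of_le _ _ h.le, Fin.contractNth_apply_of_gt _ _ _ _ h]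
    | last =>
      have h1 : ¬ (Fin.last q).castSucc < j.succ.castSucc := by
        simp
      have h2 : j.succ.castSucc ≤ (Fin.last q).succ := Fin.le_last _
      refine Subtype.ext (LinearMap.ext fun f => ?_)
      rw [if_neg h1, if_pos h2, zero_add, Fin.succ_last, symbolCochain_mul_X_last_apply,
        symbolCochain_mul_X_last_apply, ← hF]
      rfl

/-- The substitution that sets the coordinates `i ≥ k` of the last vector to zero. -/
def zeroInactive (B : Type*) [CommRing B] (m q k : ℕ) : Cochain B m q →ₐ[B] Cochain B m q :=
  aeval fun v => if v.1 = Fin.last q ∧ k ≤ (v.2 : ℕ) then 0 else X v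

theorem zeroInactive_eq_self {B : Type*} [CommRing B] [Algebra ℚ B] {F : Cochain B m q}
    (hF : F ∈ activeSubmodule B m q k) : zeroInactive B m q k F = F := by
  have h : ∀ v ∈ {v : Fin (q + 1) × Fin m | v.1 = Fin.last q ∧ k ≤ (v.2 : ℕ)},
      pderiv v F = 0 := by
    rintro ⟨l, i⟩ ⟨hl, hi⟩
    simp only at hl hi
    subst hl
    exact hF i hi
  rw [zeroInactive]
  refine aeval_eq_self_of_pderiv_eq_zero _ _ (fun v hv => ?_) F h
  exact if_neg hv

/-- The last face corresponds to the translation of the last vector by the Leibniz rule for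
`∂_i (p^* a · f)`, provided that `i < k`.  For `i ≥ k` the derivative `∂_i a` does not come from a
derivative of `p^* a`, which is why these coordinates have to be set to zero. -/
theorem hochschildLastFace_symbolCochain (F : Cochain (VerSymbol 𝕜 n k) m q) :
    hochschildLastFace (symbolCochain hkm hkn (zeroInactive _ m q k F)) =
      symbolCochain hkm hkn (coface (Fin.last _) (zeroInactive _ m q k F)) := by
  induction F using MvPolynomial.induction_on with
  | C b =>
    ext1 a
    refine Subtype.ext (LinearMap.ext fun f => ?_)
    rw [hochschildLastFace_apply, DiffOpAlong.right_smul_apply,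
      show zeroInactive _ m q k (C b) = C b from (zeroInactive _ m q k).commutes b,
      show coface _ (C b) = C b from (coface _).commutes b,
      symbolCochain_C_apply, symbolCochain_C_apply, verOp_coordProjPullback_mul,
      Fin.prod_univ_castSucc, _root_.map_mul, mul_assoc]
    rfl
  | add F G hF hG =>
    rw [map_add, map_add, map_add, map_add, ← hF, ← hG]
    ext1 a
    simp only [hochschildLastFace_apply, add_apply, smul_add]
  | mul_X F v hF =>
    obtain ⟨l, i⟩ := v
    set G := zeroInactive (VerSymbol 𝕜 n k) m q k F with hG
    rw [map_mul (zeroInactive _ m q k), ← hG]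
    ext1 a
    induction l using Fin.lastCases with
    | cast l =>
      have hX : zeroInactive (VerSymbol 𝕜 n k) m q k (X (l.castSucc, i)) = X (l.castSucc, i) := by
        simp [zeroInactive, (Fin.castSucc_lt_last l).ne]
      have h1 : l.castSucc.castSucc < Fin.last (q + 1) := Fin.castSucc_lt_last _
      have h2 : ¬ Fin.last (q + 1) ≤ l.castSucc.succ := by
        rw [not_le, Fin.succ_castSucc]; exact Fin.castSucc_lt_last _
      rw [hX, map_mul (coface _), coface_X, if_pos h1, if_neg h2, add_zero,
        symbolCochain_mul_X_castSucc, ← hF, hochschildLastFace_apply, hochschildLastFace_apply,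
        symbolCochain_mul_X_castSucc, Fin.init_update_castSucc,
        Function.update_of_ne (Fin.castSucc_lt_last _).ne']
      rfl
    | last =>
      by_cases hi : k ≤ (i : ℕ)
      · have hX : zeroInactive (VerSymbol 𝕜 n k) m q k (X (Fin.last q, i)) = 0 := by
          simp [zeroInactive, hi]
        rw [hX, mul_zero, map_zero, map_zero, map_zero, hochschildLastFace_apply]
        exact smul_zero _
      · have hX : zeroInactive (VerSymbol 𝕜 n k) m q k (X (Fin.last q, i)) = X (Fin.last q, i) := by
          simp [zeroInactive, hi]
        have h1 : (Fin.last q).castSucc < Fin.last (q + 1) := Fin.castSucc_lt_last _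
        have h2 : Fin.last (q + 1) ≤ (Fin.last q).succ := le_rfl
        refine Subtype.ext (LinearMap.ext fun f => ?_)
        rw [hX, map_mul (coface _), coface_X, if_pos h1, if_pos h2, mul_add, map_add, add_apply,
          Fin.succ_last, diffOpAlong_add_apply, symbolCochain_mul_X_last_apply,
          symbolCochain_mul_X_castSucc, ← hF, hochschildLastFace_apply, hochschildLastFace_apply,
          hochschildLastFace_apply, DiffOpAlong.right_smul_apply, DiffOpAlong.right_smul_apply,
          DiffOpAlong.right_smul_apply, symbolCochain_mul_X_last_apply, Fin.init_update_last,
          Function.update_self, baseDeriv, dif_pos (not_le.1 hi), partialDeriv_mul,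
          partialDeriv_coordProjPullback_of_lt hkm hkn _ (not_le.1 hi), map_add, add_comm]

theorem hochschildDifferential_symbolCochain {F : Cochain (VerSymbol 𝕜 n k) m q}
    (hF : zeroInactive _ m q k F = F) :
    hochschildDifferential 𝕜 (SmoothFun 𝕜 m) (DiffOpAlong (coordProjPullback 𝕜 m hkn)) q
      (symbolCochain hkm hkn F) = symbolCochain hkm hkn (PolyCobar.diff q F) := by
  rw [diff_apply, Fin.sum_univ_succ, Fin.sum_univ_castSucc, map_add, map_add, map_sum]
  simp only [map_zsmul]
  have hl := hochschildLastFace_symbolCochain hkm hkn F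
  rw [hF] at hl
  rw [Fin.succ_last, ← hl, ← hochschildFirstFace_symbolCochain, ← add_assoc]
  simp only [Fin.succ_castSucc, ← hochschildInnerFace_symbolCochain, Fin.val_zero, pow_zero,
    one_smul]
  rfl

end SymbolCochain

/-! ### Uniqueness of symbols -/

section Exponential

open MvPolynomial PolyCobar

variable (𝕜 : Type*) [RCLike 𝕜] {m n k q : ℕ}

/-- The exponential function `x ↦ exp(⟨c, x⟩)`. -/
def expFun (c : Fin n → ℝ) : SmoothFun 𝕜 n :=
  ⟨fun x => ((Real.exp (∑ i, c i * x i) : ℝ) : 𝕜), by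
    have h : ContDiff ℝ ∞ fun x : Fin n → ℝ => ∑ i, c i * x i :=
      ContDiff.sum fun i _ => contDiff_const.mul (contDiff_apply ℝ ℝ i)
    exact (RCLike.ofRealCLM (K := 𝕜)).contDiff.comp h.exp⟩

theorem expFun_apply (c : Fin n → ℝ) (x : Fin n → ℝ) :
    (expFun 𝕜 c).1 x = ((Real.exp (∑ i, c i * x i) : ℝ) : 𝕜) := rfl

theorem expFun_ne_zero (c : Fin n → ℝ) (x : Fin n → ℝ) : (expFun 𝕜 c).1 x ≠ 0 := by
  rw [expFun_apply]
  exact_mod_cast (Real.exp_pos _).ne'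

theorem partialDeriv_expFun (i : Fin n) (c : Fin n → ℝ) :
    partialDeriv 𝕜 n i (expFun 𝕜 c) = (c i : 𝕜) • expFun 𝕜 c := by
  refine SmoothFun.ext fun x => ?_
  have hsum : HasFDerivAt (fun x : Fin n → ℝ => ∑ j, c j * x j)
      (∑ j, c j • ContinuousLinearMap.proj (R := ℝ) (φ := fun _ : Fin n => ℝ) j) x :=
    HasFDerivAt.fun_sum fun j _ => (hasFDerivAt_apply j x).const_mul (c j)
  have h := ((RCLike.ofRealCLM (K := 𝕜)).hasFDerivAt (x := Real.exp (∑ j, c j * x j))).comp x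
    hsum.exp
  have h2 : fderiv ℝ (expFun 𝕜 c).1 x = _ := h.fderiv
  change fderiv ℝ (expFun 𝕜 c).1 x (Pi.single i 1) = (c i : 𝕜) * (expFun 𝕜 c).1 x
  rw [h2, expFun_apply]
  simp [Pi.single_apply, mul_comm]

/-- Evaluation of smooth functions at a point. -/
def smoothEval (x : Fin n → ℝ) : SmoothFun 𝕜 n →+* 𝕜 :=
  (Pi.evalRingHom (fun _ : Fin n → ℝ => 𝕜) x).comp (smoothSubalgebra 𝕜 n).val.toRingHom

theorem smoothEval_apply (x : Fin n → ℝ) (f : SmoothFun 𝕜 n) : smoothEval 𝕜 x f = f.1 x := rfl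

/-- Evaluation of a vertical symbol at a point of `ℝⁿ` and a covector. -/
def verEval (x e : Fin n → ℝ) : VerSymbol 𝕜 n k →+* 𝕜 :=
  eval₂Hom (smoothEval 𝕜 x) fun i => (e i : 𝕜)

theorem verOp_expFun (x e : Fin n → ℝ) (b : VerSymbol 𝕜 n k) :
    (verOp 𝕜 b (expFun 𝕜 e)).1 x = verEval 𝕜 x e b * (expFun 𝕜 e).1 x := by
  induction b using MvPolynomial.induction_on with
  | C r => rw [verOp_C, verEval, coe_eval₂Hom, eval₂_C]; rfl
  | add b c hb hc => rw [map_add, map_add, add_mul, ← hb, ← hc]; rfl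
  | mul_X b i hb =>
    rw [verOp_mul_X, Module.End.mul_apply, partialDeriv_expFun, map_smul, map_mul, mul_right_comm,
      ← hb, verEval, coe_eval₂Hom, eval₂_X, mul_comm]
    rfl

theorem eq_zero_of_verEval_eq_zero (b : VerSymbol 𝕜 n k) (h : ∀ x e, verEval 𝕜 x e b = 0) :
    b = 0 := by
  classical
  ext u
  refine SmoothFun.ext fun x => ?_
  have hx : MvPolynomial.map (smoothEval 𝕜 x) b = 0 := by
    refine funext_set (fun _ => Set.range ((↑) : ℝ → 𝕜))
      (fun _ => Set.infinite_range_of_injective RCLike.ofReal_injective) fun v hv => ?_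
    choose w hw using fun i => hv i (Set.mem_univ i)
    rw [eval_map, map_zero, ← h x fun i => if hi : k ≤ (i : ℕ) then w ⟨i, hi⟩ else 0]
    rw [verEval, coe_eval₂Hom]
    congr 1
    funext i
    rw [dif_pos i.2, hw]
  have := congrArg (coeff u) hx
  rwa [coeff_map, coeff_zero] at this

variable (hkm : k ≤ m) (hkn : k ≤ n)

/-- The point at which the symbol of a cochain is evaluated when the cochain is applied to
exponential functions. -/
def expPoint (k : ℕ) {q : ℕ} (hkn : k ≤ n) (c : Fin q → Fin m → ℝ) (e : Fin n → ℝ) :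
    Fin (q + 1) × Fin m → 𝕜 := fun v =>
  Fin.lastCases (motive := fun _ => 𝕜)
    (if h : (v.2 : ℕ) < k then (e ⟨v.2, h.trans_le hkn⟩ : 𝕜) else 1) (fun l => (c l v.2 : 𝕜)) v.1

/-- The value of a cochain at exponential functions is its symbol, up to a nonvanishing factor. -/
theorem symbolCochain_expFun (c : Fin q → Fin m → ℝ) (x e : Fin n → ℝ)
    (F : Cochain (VerSymbol 𝕜 n k) m q) :
    ((symbolCochain hkm hkn F fun l => expFun 𝕜 (c l)).1 (expFun 𝕜 e)).1 x =
      eval₂ (verEval 𝕜 x e) (expPoint 𝕜 k hkn c e) F *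
      ((∏ l, expFun 𝕜 (c l)).1 (coordProj m hkn x) * (expFun 𝕜 e).1 x) := by
  induction F using MvPolynomial.induction_on with
  | C b =>
    rw [symbolCochain_C_apply, eval₂_C]
    change _ * (verOp 𝕜 b (expFun 𝕜 e)).1 x = _
    rw [verOp_expFun]
    exact mul_left_comm _ _ _
  | add F G hF hG => rw [map_add, eval₂_add, add_mul, ← hF, ← hG]; rfl
  | mul_X F v hF =>
    obtain ⟨l, i⟩ := v
    rw [eval₂_mul, eval₂_X, mul_right_comm, ← hF, mul_comm _ (expPoint 𝕜 k hkn c e _)]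
    induction l using Fin.lastCases with
    | cast l =>
      have : expPoint 𝕜 k hkn c e (l.castSucc, i) = (c l i : 𝕜) := by simp [expPoint]
      rw [symbolCochain_mul_X_castSucc, partialDeriv_expFun, MultilinearMap.map_update_smul,
        Function.update_eq_self, this]
      rfl
    | last =>
      rw [symbolCochain_mul_X_last_apply, baseDeriv]
      by_cases h : (i : ℕ) < k
      · have : expPoint 𝕜 k hkn c e (Fin.last q, i) = (e ⟨i, h.trans_le hkn⟩ : 𝕜) := by
          simp [expPoint, h]
        rw [dif_pos h, partialDeriv_expFun, map_smul, this]
        rfl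
      · have : expPoint 𝕜 k hkn c e (Fin.last q, i) = 1 := by
          simp [expPoint, h]
        rw [dif_neg h, this, one_mul]
        rfl

theorem eval₂_zeroInactive {B S : Type*} [CommRing B] [CommRing S] (φ : B →+* S)
    (v : Fin (q + 1) × Fin m → S) (F : Cochain B m q) :
    eval₂ φ v (zeroInactive B m q k F) =
      eval₂ φ (fun w => if w.1 = Fin.last q ∧ k ≤ (w.2 : ℕ) then 0 else v w) F := by
  induction F using MvPolynomial.induction_on with
  | C b =>
    rw [show zeroInactive _ m q k (C b) = C b from (zeroInactive _ m q k).commutes b, eval₂_C,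
      eval₂_C]
  | add F G hF hG => rw [map_add, eval₂_add, eval₂_add, hF, hG]
  | mul_X F w hF =>
    rw [map_mul, eval₂_mul, eval₂_mul, hF, eval₂_X, zeroInactive, aeval_X]
    split_ifs <;> simp

/-- A cochain has at most one symbol that does not involve the ignored coordinates of the last
vector. -/
theorem eq_zero_of_symbolCochain_eq_zero {F : Cochain (VerSymbol 𝕜 n k) m q}
    (hF : zeroInactive _ m q k F = F) (h : symbolCochain hkm hkn F = 0) : F = 0 := by
  classical
  ext1 u
  rw [coeff_zero]
  refine eq_zero_of_verEval_eq_zero 𝕜 _ fun x e₀ => ?_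
  have hx : MvPolynomial.map (verEval 𝕜 x e₀) F = 0 := by
    refine funext_set (fun _ => Set.range ((↑) : ℝ → 𝕜))
      (fun _ => Set.infinite_range_of_injective RCLike.ofReal_injective) fun v hv => ?_
    choose w hw using fun i => hv i (Set.mem_univ i)
    rw [eval_map, map_zero]
    -- the covector that agrees with `e₀` on the vertical coordinates and is given by `w` otherwise
    let e : Fin n → ℝ := fun i =>
      if hi : (i : ℕ) < k then w (Fin.last q, ⟨i, hi.trans_le hkm⟩) else e₀ i
    have he : verEval 𝕜 (k := k) x e = verEval 𝕜 x e₀ := by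
      rw [verEval, verEval]
      congr 1
      funext i
      simp [e, not_lt.2 i.2]
    have h1 := symbolCochain_expFun 𝕜 hkm hkn (fun l i => w (l.castSucc, i)) x e F
    rw [h, he] at h1
    have h2 := (mul_eq_zero.1 h1.symm).resolve_right (mul_ne_zero ?_ (expFun_ne_zero 𝕜 _ _))
    · rw [← hF] at h2 ⊢
      rw [← h2, eval₂_zeroInactive, eval₂_zeroInactive]
      congr 1
      funext ⟨l, i⟩
      split_ifs with hli
      · rfl
      · induction l using Fin.lastCases with
        | cast l => simp [expPoint, hw]
        | last =>
          have hi : (i : ℕ) < k := not_le.1 fun hi => hli ⟨rfl, hi⟩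
          simp [expPoint, hi, e, hw]
    · rw [← smoothEval_apply, map_prod]
      exact Finset.prod_ne_zero_iff.2 fun l _ => expFun_ne_zero 𝕜 _ _
  have := congrArg (coeff u) hx
  rwa [coeff_map, coeff_zero] at this

end Exponential

/-! ### Existence of symbols -/

section Existence

open MvPolynomial PolyCobar

variable {𝕜 : Type*} [RCLike 𝕜] {m n k q : ℕ} (hkm : k ≤ m) (hkn : k ≤ n)

theorem symbolCochain_smul_C_apply (r : SmoothFun 𝕜 n) (F : Cochain (VerSymbol 𝕜 n k) m q)
    (a : Fin q → SmoothFun 𝕜 m) (f : SmoothFun 𝕜 n) :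
    (symbolCochain hkm hkn ((C r : VerSymbol 𝕜 n k) • F) a).1 f =
      r * (symbolCochain hkm hkn F a).1 f := by
  induction F using MvPolynomial.induction_on' with
  | monomial u b =>
    rw [smul_monomial, symbolCochain_monomial_apply, symbolCochain_monomial_apply, smul_eq_mul,
      ← smul_eq_C_mul, map_smul]
    exact mul_left_comm _ _ _
  | add F G hF hG =>
    rw [smul_add, map_add, map_add, add_apply, add_apply, diffOpAlong_add_apply,
      diffOpAlong_add_apply, hF, hG, mul_add]

theorem exists_symbolCochain_eq_iteratedPartial (I : Fin q → Fin m → ℕ) (J : Fin n → ℕ) :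
    ∃ F ∈ activeSubmodule (VerSymbol 𝕜 n k) m q k, ∀ a f, (symbolCochain hkm hkn F a).1 f =
      coordProjPullback 𝕜 m hkn (∏ l, iteratedPartial 𝕜 m (I l) (a l)) *
        iteratedPartial 𝕜 n J f := by
  let u : Fin (q + 1) × Fin m →₀ ℕ := Finsupp.equivFunOnFinite.symm fun v =>
    Fin.lastCases (motive := fun _ => ℕ)
      (if h : (v.2 : ℕ) < k then J ⟨v.2, h.trans_le hkn⟩ else 0) (fun l => I l v.2) v.1
  let v : {i : Fin n // k ≤ (i : ℕ)} →₀ ℕ := Finsupp.equivFunOnFinite.symm fun i => J i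
  have hu : ∀ l, argIndex u l = I l := fun l => by
    funext i
    simp [argIndex, u]
  have hJ : verIndex v + baseIndex n hkm u = J := by
    funext i
    by_cases h : (i : ℕ) < k
    · simp [verIndex, baseIndex, u, v, h, not_le.2 h]
    · simp [verIndex, baseIndex, u, v, h, not_lt.1 h]
  refine ⟨monomial u (monomial v 1), fun t ht => ?_, fun a f => ?_⟩
  · have : u (Fin.last q, t) = 0 := by simp [u, not_lt.2 ht]
    rw [pderiv_monomial, this, Nat.cast_zero, mul_zero, map_zero]
  · rw [symbolCochain_monomial_apply, verOp_monomial, one_smul, ← Module.End.mul_apply,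
      ← iteratedPartial_add, hJ]
    simp only [hu]

theorem exists_symbolCochain_eq
    {f : HochschildCochain 𝕜 (SmoothFun 𝕜 m) (DiffOpAlong (coordProjPullback 𝕜 m hkn)) q}
    (hf : f ∈ diffCochain 𝕜 m (DiffOpAlong (coordProjPullback 𝕜 m hkn)) q) :
    ∃ F ∈ activeSubmodule (VerSymbol 𝕜 n k) m q k, symbolCochain hkm hkn F = f := by
  induction hf using Submodule.span_induction with
  | mem f hf =>
    obtain ⟨I, ⟨D, hD⟩, hf⟩ := hf
    have key : ∃ F ∈ activeSubmodule (VerSymbol 𝕜 n k) m q k,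
        ∀ a g, (symbolCochain hkm hkn F a).1 g =
          coordProjPullback 𝕜 m hkn (∏ l, iteratedPartial 𝕜 m (I l) (a l)) * D g := by
      clear hf
      induction hD using Submodule.span_induction with
      | mem D hD =>
        obtain ⟨J, rfl⟩ := hD
        exact exists_symbolCochain_eq_iteratedPartial hkm hkn I J
      | zero => exact ⟨0, zero_mem _, fun a g => by rw [map_zero]; exact (mul_zero _).symm⟩
      | add D E _ _ hD hE =>
        obtain ⟨F, hF, hF'⟩ := hD
        obtain ⟨G, hG, hG'⟩ := hE
        refine ⟨F + G, add_mem hF hG, fun a g => ?_⟩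
        rw [map_add, add_apply, diffOpAlong_add_apply, hF', hG', ← mul_add]
        rfl
      | smul r D _ hD =>
        obtain ⟨F, hF, hF'⟩ := hD
        refine ⟨(C r : VerSymbol 𝕜 n k) • F, Submodule.smul_mem _ _ hF, fun a g => ?_⟩
        rw [symbolCochain_smul_C_apply, hF']
        exact mul_left_comm _ _ _
    obtain ⟨F, hF, hF'⟩ := key
    refine ⟨F, hF, ?_⟩
    ext1 a
    rw [hf]
    exact Subtype.ext (LinearMap.ext fun g => hF' a g)
  | zero => exact ⟨0, zero_mem _, map_zero _⟩
  | add f g _ _ hf hg =>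
    obtain ⟨F, hF, rfl⟩ := hf
    obtain ⟨G, hG, rfl⟩ := hg
    exact ⟨F + G, add_mem hF hG, map_add _ _ _⟩
  | smul r f _ hf =>
    obtain ⟨F, hF, rfl⟩ := hf
    refine ⟨(C (coordProjPullback 𝕜 m hkn r) : VerSymbol 𝕜 n k) • F, Submodule.smul_mem _ _ hF, ?_⟩
    ext1 a
    exact Subtype.ext (LinearMap.ext fun g => symbolCochain_smul_C_apply hkm hkn _ F a g)

end Existence

/-! ### Cocycles in normal form -/

section NormalForm

open MvPolynomial PolyCobar

/-- The sequences `c 0 > ⋯ > c (q - 1) ≥ k` of coordinate directions along which the projection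
on the first `k` coordinates is constant. -/
abbrev VerDirections (k m q : ℕ) : Type :=
  {c : Fin q → Fin m // StrictAnti c ∧ ∀ l, k ≤ (c l : ℕ)}

instance (k m q : ℕ) : Fintype (VerDirections k m q) := Fintype.ofFinite _

variable {𝕜 : Type*} [RCLike 𝕜] {m n k q : ℕ} (hkn : k ≤ n)

variable (𝕜 m q) in
/-- The cochain `(a₁, …, a_q) ↦ ∑_c (∂_{c 0} a₁ ⋯ ∂_{c (q - 1)} a_q) · ψ_c`. -/
def normalCochain : (VerDirections k m q → DiffOpVer 𝕜 m hkn) →ₗ[SmoothFun 𝕜 m]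
    HochschildCochain 𝕜 (SmoothFun 𝕜 m) (DiffOpAlong (coordProjPullback 𝕜 m hkn)) q :=
  ∑ c : VerDirections k m q, pureCochain (fun l => Pi.single (c.1 l) 1) ∘ₗ
    (DiffOpVer 𝕜 m hkn).subtype ∘ₗ LinearMap.proj c

theorem iteratedPartial_single (i : Fin m) :
    iteratedPartial 𝕜 m (Pi.single i 1) = partialDeriv 𝕜 m i := by
  rw [← zero_add (Pi.single i 1), iteratedPartial_add_single, iteratedPartial_zero, mul_one]

theorem normalCochain_apply (ψ : VerDirections k m q → DiffOpVer 𝕜 m hkn)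
    (a : Fin q → SmoothFun 𝕜 m) :
    normalCochain 𝕜 m q hkn ψ a = ∑ c : VerDirections k m q,
      (∏ l, partialDeriv 𝕜 m (c.1 l) (a l)) • (ψ c : DiffOpAlong (coordProjPullback 𝕜 m hkn)) := by
  simp [normalCochain, pureCochain_apply, iteratedPartial_single]

theorem normalCochain_mem_diffCochain (ψ : VerDirections k m q → DiffOpVer 𝕜 m hkn) :
    normalCochain 𝕜 m q hkn ψ ∈ diffCochain 𝕜 m (DiffOpAlong (coordProjPullback 𝕜 m hkn)) q := by
  rw [normalCochain, LinearMap.sum_apply]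
  exact sum_mem fun c _ => Submodule.subset_span ⟨_, _, pureCochain_apply _ _⟩

theorem verOp_mem_diffOp (b : VerSymbol 𝕜 n k) : verOp 𝕜 b ∈ DiffOp 𝕜 n := by
  have := verOp_mul_mem_diffOp 𝕜 b (iteratedPartial_mem_diffOp (𝕜 := 𝕜) (n := n) 0)
  rwa [iteratedPartial_zero, mul_one] at this

variable (m) in
/-- The operator with symbol `b`, as an element of the module of vertical operators. -/
def verOpVer (b : VerSymbol 𝕜 n k) : DiffOpVer 𝕜 m hkn :=
  ⟨(⟨verOp 𝕜 b, verOp_mem_diffOp b⟩ : DiffOp 𝕜 n), by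
    change verOp 𝕜 b ∈ Submodule.span (SmoothFun 𝕜 n) _
    rw [← range_verOp]
    exact ⟨b, rfl⟩⟩

theorem exists_verOpVer_eq (ψ : DiffOpVer 𝕜 m hkn) : ∃ b, verOpVer m hkn b = ψ := by
  have h : ψ.1.1 ∈ LinearMap.range (verOp 𝕜 (n := n) (k := k)) := by
    rw [range_verOp]
    exact ψ.2
  obtain ⟨b, hb⟩ := h
  exact ⟨b, Subtype.ext (Subtype.ext hb)⟩

theorem symbolCochain_smul_multilinearMonomial (hkm : k ≤ m) (b : VerSymbol 𝕜 n k)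
    (c : Fin q → Fin m) :
    symbolCochain hkm hkn (b • multilinearMonomial (VerSymbol 𝕜 n k) c) =
      pureCochain (𝕜 := 𝕜) (fun l => Pi.single (c l) 1)
        (verOpVer m hkn b : DiffOpAlong (coordProjPullback 𝕜 m hkn)) := by
  let u : Fin (q + 1) × Fin m →₀ ℕ := ∑ l : Fin q, Finsupp.single (l.castSucc, c l) 1
  have hu : b • multilinearMonomial (VerSymbol 𝕜 n k) c = monomial u b := by
    have : multilinearMonomial (VerSymbol 𝕜 n k) c = monomial u 1 := by
      simp only [multilinearMonomial, u, monomial_sum_one, X]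
    rw [this, smul_monomial, smul_eq_mul, mul_one]
  have h1 : argIndex u = fun l => Pi.single (c l) 1 := by
    funext l i
    simp [argIndex, u, Finsupp.finsetSum_apply, Finsupp.single_apply, Pi.single_apply,
      ite_and, eq_comm]
  have h2 : baseIndex n hkm u = 0 := by
    funext i
    simp [baseIndex, u, Finsupp.finsetSum_apply]
  rw [hu, symbolCochain_monomial, h1]
  congr 1
  refine Subtype.ext ?_
  change verOp 𝕜 b * iteratedPartial 𝕜 n (baseIndex n hkm u) = verOp 𝕜 b
  rw [h2, iteratedPartial_zero, mul_one]

theorem normalCochain_verOpVer (hkm : k ≤ m) (b : VerDirections k m q → VerSymbol 𝕜 n k) :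
    normalCochain 𝕜 m q hkn (fun c => verOpVer m hkn (b c)) =
      symbolCochain hkm hkn (∑ c, b c • multilinearMonomial (VerSymbol 𝕜 n k) c.1) := by
  rw [map_sum, normalCochain, LinearMap.sum_apply]
  exact Finset.sum_congr rfl fun c _ =>
    (symbolCochain_smul_multilinearMonomial hkn hkm (b c) c.1).symm

theorem mem_normalForms_iff {B : Type*} [CommRing B] {F : Cochain B m q} :
    F ∈ normalForms B m q k ↔
      ∃ b : VerDirections k m q → B, ∑ c, b c • multilinearMonomial B c.1 = F := by
  have : {F | ∃ c : Fin q → Fin m, StrictAnti c ∧ (∀ l, k ≤ (c l : ℕ)) ∧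
      multilinearMonomial B c = F} =
      Set.range fun c : VerDirections k m q => multilinearMonomial B c.1 := by
    ext F
    constructor
    · rintro ⟨c, h1, h2, rfl⟩
      exact ⟨⟨c, h1, h2⟩, rfl⟩
    · rintro ⟨c, rfl⟩
      exact ⟨c.1, c.2.1, c.2.2, rfl⟩
  rw [normalForms, this, Submodule.mem_span_range_iff_exists_fun]

instance : Algebra ℚ (VerSymbol 𝕜 n k) :=
  ((algebraMap 𝕜 (VerSymbol 𝕜 n k)).comp (algebraMap ℚ 𝕜)).toAlgebra

theorem hochschildDifferential_normalCochain (hkm : k ≤ m)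
    (ψ : VerDirections k m q → DiffOpVer 𝕜 m hkn) :
    hochschildDifferential 𝕜 (SmoothFun 𝕜 m) (DiffOpAlong (coordProjPullback 𝕜 m hkn)) q
      (normalCochain 𝕜 m q hkn ψ) = 0 := by
  choose b hb using fun c => exists_verOpVer_eq hkn (ψ c)
  obtain rfl : (fun c => verOpVer m hkn (b c)) = ψ := funext hb
  have hE := mem_normalForms_iff.2 ⟨b, rfl⟩
  rw [normalCochain_verOpVer hkn hkm, hochschildDifferential_symbolCochain hkm hkn
    (zeroInactive_eq_self (normalForms_le_activeSubmodule _ _ _ hE)),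
    diff_eq_zero_of_mem_normalForms hE, map_zero]

/-- Every differential cocycle is cohomologous to a cocycle in normal form. -/
theorem exists_sub_normalCochain_mem_diffCoboundary (hkm : k ≤ m)
    {f : HochschildCochain 𝕜 (SmoothFun 𝕜 m) (DiffOpAlong (coordProjPullback 𝕜 m hkn)) q}
    (hf : f ∈ diffCocycle 𝕜 m (DiffOpAlong (coordProjPullback 𝕜 m hkn)) q) :
    ∃ ψ, f - normalCochain 𝕜 m q hkn ψ ∈
      diffCoboundary 𝕜 m (DiffOpAlong (coordProjPullback 𝕜 m hkn)) q := by
  obtain ⟨F, hF, rfl⟩ := exists_symbolCochain_eq hkm hkn hf.1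
  have hd : PolyCobar.diff q F = 0 := by
    refine eq_zero_of_symbolCochain_eq_zero 𝕜 hkm hkn
      (zeroInactive_eq_self (diff_mem_activeSubmodule hF)) ?_
    rw [← hochschildDifferential_symbolCochain hkm hkn (zeroInactive_eq_self hF)]
    exact hf.2
  obtain ⟨E, hE, F', hF', rfl⟩ :=
    Submodule.mem_sup.1 (mem_normalForms_sup_activeCoboundaries hkm F hF hd)
  obtain ⟨b, rfl⟩ := mem_normalForms_iff.1 hE
  refine ⟨fun c => verOpVer m hkn (b c), ?_⟩
  rw [normalCochain_verOpVer hkn hkm, map_add, add_sub_cancel_left]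
  cases q with
  | zero =>
    rw [(Submodule.mem_bot _).1 hF', map_zero]
    exact zero_mem _
  | succ q =>
    obtain ⟨G, hG, rfl⟩ := hF'
    exact ⟨symbolCochain hkm hkn G, symbolCochain_mem_diffCochain hkm hkn G,
      hochschildDifferential_symbolCochain hkm hkn (zeroInactive_eq_self hG)⟩

end NormalForm

/-! ### Alternating evaluation on the coordinate functions -/

section Alternating

variable {𝕜 : Type*} [RCLike 𝕜] {m n k q : ℕ} (hkn : k ≤ n)

variable (𝕜) in
/-- The coordinate functions on `ℝᵐ`. -/
def coordFun (i : Fin m) : SmoothFun 𝕜 m :=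
  ⟨fun x => (x i : 𝕜), by
    have h : ContDiff ℝ ∞ fun x : Fin m → ℝ => x i := contDiff_apply ℝ ℝ i
    exact (RCLike.ofRealCLM (K := 𝕜)).contDiff.comp h⟩

theorem partialDeriv_coordFun (i j : Fin m) :
    partialDeriv 𝕜 m i (coordFun 𝕜 j) = if i = j then 1 else 0 := by
  refine SmoothFun.ext fun x => ?_
  have h0 : HasFDerivAt (fun x : Fin m → ℝ => x j) (ContinuousLinearMap.proj j) x :=
    hasFDerivAt_apply (𝕜 := ℝ) j x
  have h := ((RCLike.ofRealCLM (K := 𝕜)).hasFDerivAt (x := x j)).comp x h0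
  have h2 : fderiv ℝ (coordFun 𝕜 j).1 x = _ := h.fderiv
  change fderiv ℝ (coordFun 𝕜 j).1 x (Pi.single i 1) = _
  rw [h2]
  split_ifs with h
  · subst h
    simp
    rfl
  · simp [Ne.symm h]
    rfl

theorem coordProjPullback_coordFun (i : Fin m) (hi : k ≤ (i : ℕ)) :
    coordProjPullback 𝕜 m hkn (coordFun 𝕜 i) = 0 := by
  refine SmoothFun.ext fun x => ?_
  change ((coordProj m hkn x i : ℝ) : 𝕜) = 0
  simp [coordProj, not_lt.2 hi]

/-- The alternating sum of the values of a cochain under permutations of its arguments. -/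
def altEval {R A M : Type*} [CommRing R] [CommRing A] [Algebra R A] [AddCommGroup M] [Module R M]
    (f : HochschildCochain R A M q) (v : Fin q → A) : M :=
  ∑ τ : Equiv.Perm (Fin q), (τ.sign : ℤ) • f (v ∘ τ)

theorem contractNth_comp_swap {A : Type*} [CommRing A] (j : Fin q) (v : Fin (q + 1) → A) :
    Fin.contractNth j.castSucc (· * ·) (v ∘ Equiv.swap j.castSucc j.succ) =
      Fin.contractNth j.castSucc (· * ·) v := by
  funext l
  rcases lt_trichotomy l j with h | rfl | h
  · rw [Fin.contractNth_apply_of_lt _ _ _ _ h, Fin.contractNth_apply_of_lt _ _ _ _ h,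
      Function.comp_apply, Equiv.swap_apply_of_ne_of_ne]
    · exact fun e => h.ne (Fin.castSucc_injective _ e)
    · exact ((Fin.castSucc_lt_castSucc_iff.2 h).trans Fin.castSucc_lt_succ).ne
  · rw [Fin.contractNth_apply_of_eq _ _ _ _ rfl, Fin.contractNth_apply_of_eq _ _ _ _ rfl,
      Function.comp_apply, Function.comp_apply, Equiv.swap_apply_left, Equiv.swap_apply_right,
      mul_comm]
  · rw [Fin.contractNth_apply_of_gt _ _ _ _ h, Fin.contractNth_apply_of_gt _ _ _ _ h,
      Function.comp_apply, Equiv.swap_apply_of_ne_of_ne]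
    · exact (Fin.castSucc_lt_succ.trans (Fin.succ_lt_succ_iff.2 h)).ne'
    · exact fun e => h.ne' (Fin.succ_injective _ e)

/-- Inner faces are symmetric in two neighbouring arguments, so they are killed by alternation. -/
theorem altEval_hochschildInnerFace {R A M : Type*} [CommRing R] [CommRing A] [Algebra R A]
    [AddCommGroup M] [Module R M] (j : Fin q) (f : HochschildCochain R A M q)
    (v : Fin (q + 1) → A) : altEval (hochschildInnerFace j f) v = 0 := by
  have hne : j.castSucc ≠ j.succ := Fin.castSucc_lt_succ.ne
  refine Finset.sum_involution (fun τ _ => τ * Equiv.swap j.castSucc j.succ) (fun τ _ => ?_)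
    (fun τ _ _ h => ?_) (fun τ _ => Finset.mem_univ _) (fun τ _ => by simp [mul_assoc])
  · rw [Equiv.Perm.sign_mul, Equiv.Perm.sign_swap hne, hochschildInnerFace_apply,
      hochschildInnerFace_apply, Equiv.Perm.coe_mul, ← Function.comp_assoc, contractNth_comp_swap]
    simp
  · rw [mul_eq_left] at h
    exact hne (Equiv.swap_eq_one_iff.1 h)

/-- Alternating evaluation on coordinate functions that vanish on the image of the projection
kills all coboundaries. -/
theorem altEval_coordFun_eq_zero_of_mem_diffCoboundary
    {f : HochschildCochain 𝕜 (SmoothFun 𝕜 m) (DiffOpAlong (coordProjPullback 𝕜 m hkn)) q}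
    (hf : f ∈ diffCoboundary 𝕜 m (DiffOpAlong (coordProjPullback 𝕜 m hkn)) q)
    (c : Fin q → Fin m) (hc : ∀ l, k ≤ (c l : ℕ)) :
    altEval f (fun l => coordFun 𝕜 (c l)) = 0 := by
  cases q with
  | zero =>
    obtain rfl : f = 0 := hf
    exact Finset.sum_eq_zero fun τ _ => smul_zero _
  | succ q =>
    obtain ⟨g, -, rfl⟩ := hf
    have h : ∀ τ : Equiv.Perm (Fin (q + 1)),
        hochschildDifferential 𝕜 (SmoothFun 𝕜 m) (DiffOpAlong (coordProjPullback 𝕜 m hkn)) q g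
          ((fun l => coordFun 𝕜 (c l)) ∘ τ) =
        ∑ j : Fin q, (-1 : ℤ) ^ (j.val + 1) •
          hochschildInnerFace j g ((fun l => coordFun 𝕜 (c l)) ∘ τ) := by
      intro τ
      have h1 : hochschildFirstFace g ((fun l => coordFun 𝕜 (c l)) ∘ τ) = 0 := by
        refine Subtype.ext (LinearMap.ext fun f => ?_)
        rw [hochschildFirstFace_apply, DiffOpAlong.left_smul_apply, Function.comp_apply,
          coordProjPullback_coordFun hkn _ (hc _), zero_mul]
        rfl
      have h2 : hochschildLastFace g ((fun l => coordFun 𝕜 (c l)) ∘ τ) = 0 := by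
        refine Subtype.ext (LinearMap.ext fun f => ?_)
        rw [hochschildLastFace_apply, DiffOpAlong.right_smul_apply, Function.comp_apply,
          coordProjPullback_coordFun hkn _ (hc _), zero_mul, map_zero]
        rfl
      change hochschildFirstFace g _ + (∑ j : Fin q, (-1 : ℤ) ^ (j.val + 1) •
        hochschildInnerFace j g) _ + (-1 : ℤ) ^ (q + 1) • hochschildLastFace g _ = _
      rw [h1, h2, smul_zero, add_zero, zero_add, sum_apply]
      rfl
    rw [altEval]
    simp only [h, Finset.smul_sum]
    rw [Finset.sum_comm]
    refine Finset.sum_eq_zero fun j _ => ?_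
    have := altEval_hochschildInnerFace j g fun l => coordFun 𝕜 (c l)
    rw [altEval] at this
    simp only [smul_comm _ ((-1 : ℤ) ^ (j.val + 1)), ← Finset.smul_sum, this, smul_zero]

theorem eq_one_of_strictAnti_comp {α : Type*} [LinearOrder α] {c : Fin q → α} (hc : StrictAnti c)
    (τ : Equiv.Perm (Fin q)) (h : StrictAnti (c ∘ τ)) : τ = 1 := by
  have hm : StrictMono τ := fun a b hab => hc.lt_iff_gt.1 (h hab)
  have := Subsingleton.elim (hm.orderIsoOfSurjective τ τ.surjective) (OrderIso.refl _)
  ext a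
  exact congrArg Fin.val (DFunLike.congr_fun this a)

/-- Alternating evaluation recovers the coefficients of a cochain in normal form. -/
theorem altEval_normalCochain (ψ : VerDirections k m q → DiffOpVer 𝕜 m hkn)
    (c : VerDirections k m q) :
    altEval (normalCochain 𝕜 m q hkn ψ) (fun l => coordFun 𝕜 (c.1 l)) = ψ c := by
  have hp : ∀ (τ : Equiv.Perm (Fin q)) (d : VerDirections k m q),
      (∏ l, partialDeriv 𝕜 m (d.1 l) (((fun l => coordFun 𝕜 (c.1 l)) ∘ τ) l)) =
        if τ = 1 ∧ d = c then 1 else 0 := by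
    intro τ d
    simp only [Function.comp_apply, partialDeriv_coordFun]
    split_ifs with h
    · obtain ⟨rfl, rfl⟩ := h
      exact Finset.prod_eq_one fun l _ => if_pos rfl
    · by_cases hd : ∀ l, d.1 l = c.1 (τ l)
      · have hτ : τ = 1 := eq_one_of_strictAnti_comp c.2.1 τ
          ((show d.1 = c.1 ∘ τ from funext hd) ▸ d.2.1)
        subst hτ
        exact absurd ⟨rfl, Subtype.ext (funext hd)⟩ h
      · push Not at hd
        obtain ⟨l, hl⟩ := hd
        exact Finset.prod_eq_zero (Finset.mem_univ l) (if_neg hl)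
  rw [altEval, Finset.sum_eq_single 1, normalCochain_apply, Finset.sum_eq_single c]
  · rw [hp, if_pos ⟨rfl, rfl⟩]
    simp
  · intro d _ hd
    rw [hp, if_neg fun h => hd h.2, zero_smul]
  · simp
  · intro τ _ hτ
    rw [normalCochain_apply, Finset.sum_eq_zero, smul_zero]
    intro d _
    rw [hp, if_neg fun h => hτ h.1, zero_smul]
  · simp

end Alternating

/-! ### The cohomology and the exterior power -/

section Exterior

open Set (powersetCard)

variable {𝕜 : Type*} [RCLike 𝕜] {m n k q : ℕ}

/-- A family of directions corresponds to an increasing sequence in `Fin (m - k)`, by numbering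
the coordinates from the last one. -/
def verDirectionsEquiv (hkm : k ≤ m) : (Fin q ↪o Fin (m - k)) ≃ VerDirections k m q where
  toFun i := ⟨fun l => ⟨m - 1 - i l, by have := (i l).2; omega⟩, fun a b hab => by
    have := i.strictMono hab
    rw [Fin.lt_def] at this ⊢
    have := (i b).2
    simp only
    omega, fun l => by
    have := (i l).2
    simp only
    omega⟩
  invFun c := OrderEmbedding.ofStrictMono
    (fun l => ⟨m - 1 - c.1 l, by have := (c.1 l).2; have := c.2.2 l; omega⟩) fun a b hab => by
    have := c.2.1 hab
    rw [Fin.lt_def] at this ⊢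
    have := (c.1 a).2
    simp only
    omega
  left_inv i := by
    ext l
    have := (i l).2
    change m - 1 - (m - 1 - (i l : ℕ)) = i l
    omega
  right_inv c := by
    ext l
    have := (c.1 l).2
    change m - 1 - (m - 1 - (c.1 l : ℕ)) = c.1 l
    omega

variable (q) in
/-- The basis of the exterior power given by the exterior products of the standard basis
vectors. -/
def exteriorBasis (hkm : k ≤ m) :
    Module.Basis (VerDirections k m q) ℝ (⋀[ℝ]^q (Fin (m - k) → ℝ)) :=
  ((Pi.basisFun ℝ (Fin (m - k))).exteriorPower q).reindex
    (powersetCard.ofFinEmbEquiv.symm.trans (verDirectionsEquiv hkm))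

/-- A tensor product with a module with a finite basis, as a power of the first factor. -/
def tensorBasisEquiv {A R ι N V : Type*} [CommRing A] [CommRing R] [Fintype ι] [AddCommGroup N]
    [AddCommGroup V] [Module R N] [Module A N] [SMulCommClass R A N] [Module R V]
    (b : Module.Basis ι R V) : (ι → N) ≃ₗ[A] N ⊗[R] V := by
  classical
  refine LinearEquiv.ofBijective
    { toFun := fun ψ => ∑ i, ψ i ⊗ₜ[R] b i
      map_add' := fun ψ φ => by simp [TensorProduct.add_tmul, Finset.sum_add_distrib]
      map_smul' := fun a ψ => by simp [Finset.smul_sum, TensorProduct.smul_tmul'] } ?_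
  convert ((Finsupp.linearEquivFunOnFinite R N ι).symm.trans
    (TensorProduct.equivFinsuppOfBasisRight (M := N) b).symm).bijective using 1
  funext ψ
  simp [Finsupp.sum_fintype]

variable (𝕜 q) in
/-- The class of a cocycle in normal form. -/
def normalClass (hkm : k ≤ m) (hkn : k ≤ n) :
    (VerDirections k m q → DiffOpVer 𝕜 m hkn) →ₗ[SmoothFun 𝕜 m]
      DiffHochschildCohomology 𝕜 m (DiffOpAlong (coordProjPullback 𝕜 m hkn)) q :=
  (Submodule.mkQ _) ∘ₗ (normalCochain 𝕜 m q hkn).codRestrict _ fun ψ =>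
    ⟨normalCochain_mem_diffCochain hkn ψ, hochschildDifferential_normalCochain hkn hkm ψ⟩

theorem normalClass_bijective (hkm : k ≤ m) (hkn : k ≤ n) :
    Function.Bijective (normalClass 𝕜 q hkm hkn) := by
  constructor
  · rw [← LinearMap.ker_eq_bot, LinearMap.ker_eq_bot']
    intro ψ hψ
    have h : normalCochain 𝕜 m q hkn ψ ∈
        diffCoboundary 𝕜 m (DiffOpAlong (coordProjPullback 𝕜 m hkn)) q := by
      rw [normalClass, LinearMap.comp_apply, Submodule.mkQ_apply,
        Submodule.Quotient.mk_eq_zero] at hψ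
      exact hψ
    funext c
    refine Subtype.ext ?_
    rw [← altEval_normalCochain hkn ψ c]
    exact altEval_coordFun_eq_zero_of_mem_diffCoboundary hkn h c.1 c.2.2
  · intro x
    obtain ⟨f, rfl⟩ := Submodule.mkQ_surjective _ x
    obtain ⟨ψ, hψ⟩ := exists_sub_normalCochain_mem_diffCoboundary hkn hkm f.2
    refine ⟨ψ, ((Submodule.Quotient.eq _).2 ?_).symm⟩
    exact hψ

end Exterior

theorem mainTheorem5 (𝕜 : Type*) [RCLike 𝕜] (m n k : ℕ) (hkm : k ≤ m) (hkn : k ≤ n) (q : ℕ) :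
    Nonempty
      (DiffHochschildCohomology 𝕜 m (DiffOpAlong (coordProjPullback 𝕜 m hkn)) q
        ≃ₗ[SmoothFun 𝕜 m]
      (DiffOpVer 𝕜 m hkn ⊗[ℝ] ⋀[ℝ]^q (Fin (m - k) → ℝ))) :=
  ⟨(LinearEquiv.ofBijective _ (normalClass_bijective hkm hkn)).symm.trans
    (tensorBasisEquiv (exteriorBasis q hkm))⟩

end
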